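/- Gates are unitary operators on finitely many qubits, and a circuit on $N$ qubits is a finite sequence of gates, each applied to an ordered tuple of distinct qubits; its SIZE is its number of gates. Say that a circuit $W$ on $n+m$ qubits *performs* an operator $A$ on $n$ qubits *with* the string $x\in\{0,1\}^m$ if $W(|y\rangle\otimes|x\rangle)=A|y\rangle\otimes|x\rangle$ for all $y\in\{0,1\}^n$. An operator is *implementable* over a set $G$ of gates if some circuit with gates from $G$ performs it with some string (the ancilla qubits). $G$ is *closed under controlled operation* if for every $g\in G$ the controlled gate $|c\rangle|t\rangle\mapsto|c\rangle g^c|t\rangle$ is implementable over $G$ (so by a circuit of constant size). A circuit $U$ on $n+m$ qubits is *universal* for a collection $\mathcal C$ of circuits on $n$ qubits if for every $C\in\mathcal C$ there is an encoding $x\in\{0,1\}^m$ with which $U$ performs $C$. **Theorem.** Let $G$ be a finite set of single-qubit and $2$-qubit gates that is closed under controlled operation and over which the swap $|a,b\rangle\mapsto|b,a\rangle$ is implementable. Then there are a constant $k$ (depending only on $G$) and a family of circuits $U_{n,c}$ ($n\ge 1$, $c\ge 0$), with gates from $G$, such that $U_{n,c}$ is universal for the circuits on $n$ qubits with at most $c$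 gates, all from $G$, and $$\mathrm{SIZE}(U_{n,c})\le k\,(n+c)\log(n+c).$$ -/

import Mathlib

namespace UniversalQC

open scoped Matrix

/-- Bit strings of length `n`, i.e. labels of the computational basis of `n` qubits. -/
abbrev Bits (n : ℕ) : Type := Fin n → Bool

/-- State vectors of `n` qubits, in coordinates with respect to the computational basis. -/
abbrev State (n : ℕ) : Type := Bits n → ℂ

/-- Linear operators on `n` qubits, as matrices in the computational basis. -/
abbrev Op (n : ℕ) : Type := Matrix (Bits n) (Bits n) ℂ

/-- The computational basis state `|y⟩`. -/
noncomputable def ket {n : ℕ} (y : Bits n) : State n := fun z => if z = y then 1 else 0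

/-- The tensor product `ψ ⊗ φ`: the first `n` qubits carry `ψ`, the last `m` qubits carry `φ`. -/
noncomputable def tensor {n m : ℕ} (ψ : State n) (φ : State m) : State (n + m) :=
  fun z => ψ (fun i => z (Fin.castAdd m i)) * φ (fun j => z (Fin.natAdd n j))

/-- A quantum gate: a unitary operator on `width` qubits. -/
structure Gate where
  width : ℕ
  op : Matrix.unitaryGroup (Bits width) ℂ

/-- A gate applied to an ordered tuple of distinct qubits among `N` qubits. -/
structure PlacedGate (N : ℕ) where
  gate : Gate
  wires : Fin gate.width ↪ Fin N

/-- The operator on all `N` qubits: the gate acts on its wires, the identity on all other qubits. -/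
noncomputable def PlacedGate.toOp {N : ℕ} (p : PlacedGate N) : Op N :=
  fun z' z =>
    if ∀ i : Fin N, (∀ j, p.wires j ≠ i) → z' i = z i then
      (p.gate.op : Op p.gate.width) (fun j => z' (p.wires j)) (fun j => z (p.wires j))
    else 0

/-- A quantum circuit on `N` qubits: a finite sequence of placed gates, first gate first. -/
abbrev Circuit (N : ℕ) : Type := List (PlacedGate N)

/-- The number of gates. -/
def Circuit.size {N : ℕ} (C : Circuit N) : ℕ := List.length C

/-- The operator computed by a circuit. -/
noncomputable def Circuit.toOp {N : ℕ} : Circuit N → Op N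
  | [] => 1
  | p :: C => Circuit.toOp C * p.toOp

/-- All gates of the circuit are drawn from the gate set `G`. -/
def Circuit.IsOver {N : ℕ} (G : Set Gate) (C : Circuit N) : Prop := ∀ p ∈ C, p.gate ∈ G

/-- With the string `x` on its last `m` qubits, the circuit `W` performs `A` on the first `n`
qubits and gives `x` back: `W (|y⟩ ⊗ |x⟩) = A |y⟩ ⊗ |x⟩` for all strings `y`. -/
def Circuit.Performs {n m : ℕ} (W : Circuit (n + m)) (x : Bits m) (A : Op n) : Prop :=
  ∀ y : Bits n, Circuit.toOp W *ᵥ tensor (ket y) (ket x) = tensor (A *ᵥ ket y) (ket x)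

/-- `U`, on `n` data qubits and `m` encoding qubits, is universal for the collection `𝒞` of
`n`-qubit circuits. -/
def Circuit.IsUniversalFor {n m : ℕ} (U : Circuit (n + m)) (𝒞 : Set (Circuit n)) : Prop :=
  ∀ C ∈ 𝒞, ∃ x : Bits m, U.Performs x (Circuit.toOp C)

/-- The operator `A` can be implemented exactly by a circuit with gates from `G`, using finitely
many ancilla qubits that start in a fixed basis state and are returned to it. -/
def Implementable (G : Set Gate) {n : ℕ} (A : Op n) : Prop :=
  ∃ (m : ℕ) (W : Circuit (n + m)) (x : Bits m), W.IsOver G ∧ W.Performs x A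

/-- The controlled version `|c⟩|t⟩ ↦ |c⟩ A^c |t⟩`; the control is qubit `0`. -/
noncomputable def controlled {w : ℕ} (A : Op w) : Op (w + 1) :=
  fun z' z =>
    if z' 0 = z 0 then
      (if z 0 then A else 1) (Fin.tail z') (Fin.tail z)
    else 0

/-- `G` is closed under controlled operation. As the implementing circuit of each controlled gate
is a fixed one, its size and depth are constants. -/
def ClosedUnderControl (G : Set Gate) : Prop :=
  ∀ g ∈ G, Implementable G (controlled (g.op : Op g.width))

/-- The operator `|a, b⟩ ↦ |b, a⟩` on two qubits. -/
noncomputable def swapOp : Op 2 :=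
  fun z' z => if z' 0 = z 1 ∧ z' 1 = z 0 then 1 else 0

/-- The circuits on `n` qubits with at most `c` gates, all of them from `G`. -/
def circuitsOfSize (G : Set Gate) (n c : ℕ) : Set (Circuit n) :=
  {C | C.IsOver G ∧ C.size ≤ c}

end UniversalQC

namespace UniversalQC

open scoped Matrix
open Function

/-! A control qubit in a basis state switches a gate on or off. Closure under control therefore
makes each gate of `G` optional at constant cost, the choice being stored in program qubits that are
given back unchanged (`programmable_gate`). The swap becomes optional in the same way, by
controlling every gate of a circuit that implements it (`programmable_swap`). Hence a fixed sequence
of optional moves can be programmed to run any of its subsequences, at constant cost per move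
(`programmable_sublists`). What is needed is one sequence of `O((n + c) log (n + c))` swaps and
gates in which every circuit in question can be found, up to moving qubits around, as a subsequence.

The logical qubits travel as tokens on the wires of a switching network. A single position `o` is
accessible, at successive times called holes. The first `n` holes load the tokens and the last `n`
unload them. Each gate gets three holes in between: its first qubit is parked in a buffer, its
second qubit appears at `o` and the gate is applied to buffer and `o`, then the first qubit returns
to the network (`exists_placement_gate`). All gates of `G` are offered at the middle hole. Thus only
the order in which the tokens visit the holes depends on the circuit, and the network has to carry
each token from a hole to the next one that it visits (`exists_routing`).

The network is built by doubling (`exists_network`), as for Beneš networks. The holes are grouped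
into pairs, and the arcs `t ↦ ρ t` are two-coloured so that the two arcs leaving a pair, and the two
entering it, differ in colour (`exists_arc_coloring`). Each colour is a permutation of the pairs and
is routed by its own copy of the half-size network. Three further switches per pair select the copy
and the order within the pair, so `N` holes cost `O(N log N)` switches. -/

/-! ### Local maps and padded states on labelled registers -/

/-- State vectors of a register whose qubits are labelled by `ι`. -/
abbrev QState (ι : Type) : Type := (ι → Bool) → ℂ

/-- The map `F` acting on the qubits `e k`, the identity on all other qubits. -/
noncomputable def act {κ ι : Type} (e : κ → ι) (F : QState κ → QState κ) :
    QState ι → QState ι :=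
  fun ψ z => F (fun u => ψ (extend e u z)) (z ∘ e)

open Classical in
/-- The state whose qubits `π a` carry `ψ`, while all others are in the basis state `b`. -/
noncomputable def pad {α ι : Type} (π : α → ι) (b : ι → Bool) (ψ : QState α) : QState ι :=
  fun z => if ∀ i, i ∉ Set.range π → z i = b i then ψ (z ∘ π) else 0

theorem extend_extend_same {κ ι γ : Type} {e : κ → ι} (he : Injective e) (u v : κ → γ)
    (z : ι → γ) : extend e v (extend e u z) = extend e v z := by
  funext i
  by_cases h : ∃ k, e k = i
  · obtain ⟨k, rfl⟩ := h
    simp [he.extend_apply]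
  · simp [extend_apply' _ _ _ h]

theorem extend_comp_self' {κ ι γ : Type} {e : κ → ι} (z : ι → γ) : extend e (z ∘ e) z = z := by
  funext i
  by_cases h : ∃ k, e k = i
  · simp only [extend, h, dif_pos, comp_apply]
    exact congrArg z h.choose_spec
  · simp [extend_apply' _ _ _ h]

theorem extend_extend_comp {κ ι μ γ : Type} {e : κ → ι} {w : μ → κ} (he : Injective e)
    (hw : Injective w) (v : μ → γ) (z : ι → γ) :
    extend e (extend w v (z ∘ e)) z = extend (e ∘ w) v z := by
  funext i
  by_cases h : ∃ k, e k = i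
  · obtain ⟨k, rfl⟩ := h
    rw [he.extend_apply]
    by_cases h' : ∃ l, w l = k
    · obtain ⟨l, rfl⟩ := h'
      rw [hw.extend_apply, show e (w l) = (e ∘ w) l from rfl, (he.comp hw).extend_apply]
    · rw [extend_apply' _ _ _ h', extend_apply']
      · rfl
      · rintro ⟨l, hl⟩
        exact h' ⟨l, he hl⟩
  · rw [extend_apply' _ _ _ h, extend_apply']
    rintro ⟨l, hl⟩
    exact h ⟨w l, hl⟩

theorem act_id {κ ι : Type} (e : κ → ι) : act e id = id := by
  funext ψ z
  simp [act, extend_comp_self']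

theorem act_id_map {ι : Type} (F : QState ι → QState ι) : act id F = F := by
  funext ψ z
  have : ∀ u : ι → Bool, extend id u z = u := fun u => by
    funext i
    exact injective_id.extend_apply u z i
  simp [act, this]

theorem act_comp {κ ι : Type} {e : κ → ι} (he : Injective e) (F F' : QState κ → QState κ) :
    act e (F ∘ F') = act e F ∘ act e F' := by
  funext ψ z
  have : ∀ u, extend e u z ∘ e = u := fun u => by
    funext k
    exact he.extend_apply u z k
  simp [act, this, extend_extend_same he]

theorem act_act {κ ι μ : Type} {e : κ → ι} {w : μ → κ} (he : Injective e) (hw : Injective w)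
    (F : QState μ → QState μ) : act e (act w F) = act (e ∘ w) F := by
  funext ψ z
  simp only [act, extend_extend_comp he hw]
  rfl

theorem pad_id {α : Type} (b : α → Bool) (ψ : QState α) : pad id b ψ = ψ := by
  funext z
  simp [pad]

/-- A map that acts as `F` on the padded states of `π` acts locally as `F` on the states padded
along any larger register. -/
theorem act_pad {α β ι ι' : Type} {π : α → ι} {b : ι → Bool} {F : QState α → QState α}
    {H : QState ι → QState ι} (hH : ∀ ψ, H (pad π b ψ) = pad π b (F ψ)) (hH0 : H 0 = 0)
    {e : ι → ι'} {π' : β → ι'} {σ : α → β} (he : Injective e)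
    (hπ' : Injective π') (hσ : Injective σ) (hcomm : ∀ a, e (π a) = π' (σ a))
    {b' : ι' → Bool} (hdisj : ∀ k, k ∉ Set.range π → e k ∉ Set.range π')
    (hb : ∀ k, k ∉ Set.range π → b' (e k) = b k) (ψ : QState β) :
    act e H (pad π' b' ψ) = pad π' b' (act σ F ψ) := by
  classical
  funext z
  have hslice : (fun u => pad π' b' ψ (extend e u z)) =
      if ∀ i, i ∉ Set.range π' → i ∉ Set.range e → z i = b' i then
        pad π b (fun v => ψ (extend σ v (z ∘ π'))) else 0 := by
    funext u
    have hc : (∀ i, i ∉ Set.range π' → extend e u z i = b' i) ↔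
        (∀ i, i ∉ Set.range π' → i ∉ Set.range e → z i = b' i) ∧
          ∀ k, k ∉ Set.range π → u k = b k := by
      constructor
      · intro h
        refine ⟨fun i hi hi' => ?_, fun k hk => ?_⟩
        · rw [← h i hi, extend_apply' _ _ _ hi']
        · rw [← hb k hk, ← h _ (hdisj k hk), he.extend_apply]
      · rintro ⟨h1, h2⟩ i hi
        by_cases h : i ∈ Set.range e
        · obtain ⟨k, rfl⟩ := h
          have hk : k ∉ Set.range π := by
            rintro ⟨a, rfl⟩
            exact hi ⟨σ a, (hcomm a).symm⟩
          rw [he.extend_apply, h2 k hk, hb k hk]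
        · rw [extend_apply' _ _ _ h, h1 i hi h]
    have hv : extend e u z ∘ π' = extend σ (u ∘ π) (z ∘ π') := by
      funext j
      by_cases h : ∃ a, σ a = j
      · obtain ⟨a, rfl⟩ := h
        rw [hσ.extend_apply, comp_apply, ← hcomm, he.extend_apply]
        rfl
      · rw [extend_apply' _ _ _ h, comp_apply, extend_apply', comp_apply]
        rintro ⟨k, hk⟩
        by_cases hkr : k ∈ Set.range π
        · obtain ⟨a, rfl⟩ := hkr
          exact h ⟨a, hπ' (by rw [← hcomm, hk])⟩
        · exact hdisj k hkr ⟨j, hk.symm⟩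
    by_cases h1 : ∀ i, i ∉ Set.range π' → i ∉ Set.range e → z i = b' i
    · rw [if_pos h1]
      simp only [pad, hc, hv]
      by_cases h2 : ∀ k, k ∉ Set.range π → u k = b k
      · rw [if_pos ⟨h1, h2⟩, if_pos h2]
      · rw [if_neg (fun h => h2 h.2), if_neg h2]
    · rw [if_neg h1]
      simp only [pad, hc]
      rw [if_neg (fun h => h1 h.1)]
      rfl
  have hcz : (∀ i, i ∉ Set.range π' → z i = b' i) ↔
        (∀ i, i ∉ Set.range π' → i ∉ Set.range e → z i = b' i) ∧
          ∀ k, k ∉ Set.range π → (z ∘ e) k = b k := by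
    constructor
    · intro h
      exact ⟨fun i hi _ => h i hi, fun k hk => by rw [comp_apply, h _ (hdisj k hk), hb k hk]⟩
    · rintro ⟨h1, h2⟩ i hi
      by_cases h : i ∈ Set.range e
      · obtain ⟨k, rfl⟩ := h
        have hk : k ∉ Set.range π := by
          rintro ⟨a, rfl⟩
          exact hi ⟨σ a, (hcomm a).symm⟩
        rw [hb k hk, ← h2 k hk]
        rfl
      · exact h1 i hi h
  have hzc : (z ∘ e) ∘ π = (z ∘ π') ∘ σ := by
    funext a
    exact congrArg z (hcomm a)
  unfold act
  rw [hslice]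
  by_cases h1 : ∀ i, i ∉ Set.range π' → i ∉ Set.range e → z i = b' i
  · rw [if_pos h1, hH]
    simp only [pad, hcz, hzc]
    by_cases h2 : ∀ k, k ∉ Set.range π → (z ∘ e) k = b k
    · rw [if_pos h2, if_pos ⟨h1, h2⟩]
    · rw [if_neg h2, if_neg (fun h => h2 h.2)]
  · rw [if_neg h1, hH0]
    simp only [pad, hcz]
    rw [if_neg (fun h => h1 h.1)]
    rfl

theorem pad_comp {α β ι : Type} {π : β → ι} (hπ : Injective π) {ρ : α → β} (b : ι → Bool)
    (p : β → Bool) (ψ : QState α) :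
    pad (π ∘ ρ) (extend π p b) ψ = pad π b (pad ρ p ψ) := by
  classical
  funext z
  have hc : (∀ i, i ∉ Set.range (π ∘ ρ) → z i = extend π p b i) ↔
      (∀ i, i ∉ Set.range π → z i = b i) ∧ ∀ j, j ∉ Set.range ρ → (z ∘ π) j = p j := by
    constructor
    · intro h
      refine ⟨fun i hi => ?_, fun j hj => ?_⟩
      · rw [h i, extend_apply' _ _ _ hi]
        rintro ⟨a, rfl⟩
        exact hi ⟨ρ a, rfl⟩
      · rw [comp_apply, h, hπ.extend_apply]
        rintro ⟨a, ha⟩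
        exact hj ⟨a, hπ ha⟩
    · rintro ⟨h1, h2⟩ i hi
      by_cases h : i ∈ Set.range π
      · obtain ⟨j, rfl⟩ := h
        rw [hπ.extend_apply, ← h2 j]
        · rfl
        · rintro ⟨a, rfl⟩
          exact hi ⟨a, rfl⟩
      · rw [h1 i h, extend_apply' _ _ _ h]
  simp only [pad, hc]
  by_cases h1 : ∀ i, i ∉ Set.range π → z i = b i
  · by_cases h2 : ∀ j, j ∉ Set.range ρ → (z ∘ π) j = p j
    · rw [if_pos ⟨h1, h2⟩, if_pos h1, if_pos h2]
      rfl
    · rw [if_neg (fun h => h2 h.2), if_pos h1, if_neg h2]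
  · rw [if_neg (fun h => h1 h.1), if_neg h1]

/-! ### Circuits on labelled registers -/

/-- A gate applied to distinct qubits of a register labelled by `ι`. -/
structure WiredGate (ι : Type) where
  gate : Gate
  wires : Fin gate.width → ι
  inj : Injective wires

/-- The action of a wired gate on states. -/
noncomputable def WiredGate.apply {ι : Type} (p : WiredGate ι) : QState ι → QState ι :=
  act p.wires (fun φ => (p.gate.op : Op p.gate.width) *ᵥ φ)

/-- Relabelling the qubits. -/
def WiredGate.map {ι ι' : Type} (e : ι ↪ ι') (p : WiredGate ι) : WiredGate ι' :=
  ⟨p.gate, e ∘ p.wires, e.injective.comp p.inj⟩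

/-- The action of a sequence of wired gates, first gate first. -/
noncomputable def run {ι : Type} : List (WiredGate ι) → QState ι → QState ι
  | [], ψ => ψ
  | p :: C, ψ => run C (p.apply ψ)

theorem run_append {ι : Type} (C D : List (WiredGate ι)) (ψ : QState ι) :
    run (C ++ D) ψ = run D (run C ψ) := by
  induction C generalizing ψ with
  | nil => rfl
  | cons p C ih => exact ih _

theorem act_zero {κ ι : Type} {e : κ → ι} {F : QState κ → QState κ} (hF : F 0 = 0) :
    act e F 0 = 0 := by
  funext z
  change F 0 (z ∘ e) = 0
  rw [hF]
  rfl

theorem WiredGate.apply_zero {ι : Type} (p : WiredGate ι) : p.apply 0 = 0 :=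
  act_zero (Matrix.mulVec_zero _)

theorem run_zero {ι : Type} (C : List (WiredGate ι)) : run C 0 = 0 := by
  induction C with
  | nil => rfl
  | cons p C ih => rw [run, p.apply_zero, ih]

theorem run_map {ι ι' : Type} (e : ι ↪ ι') (C : List (WiredGate ι)) :
    run (C.map (WiredGate.map e)) = act e (run C) := by
  induction C with
  | nil => exact (act_id e).symm
  | cons p C ih =>
    have h : run (p :: C) = run C ∘ p.apply := rfl
    rw [h, act_comp e.injective, ← ih, WiredGate.apply, act_act e.injective p.inj]
    rfl

/-- The circuit `U` performs `F` on the qubits `π a`, all other qubits being in the basis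
state `b` before and after. -/
def Realizes {α ι : Type} (U : List (WiredGate ι)) (π : α → ι) (b : ι → Bool)
    (F : QState α → QState α) : Prop :=
  ∀ ψ, run U (pad π b ψ) = pad π b (F ψ)

theorem Realizes.append {α ι : Type} {U V : List (WiredGate ι)} {π : α → ι} {b : ι → Bool}
    {F F' : QState α → QState α} (hU : Realizes U π b F) (hV : Realizes V π b F') :
    Realizes (U ++ V) π b (F' ∘ F) := fun ψ => by
  rw [run_append, hU, hV, comp_apply]

theorem Realizes.map {α β ι ι' : Type} {U : List (WiredGate ι)} {π : α → ι} {b : ι → Bool}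
    {F : QState α → QState α} (hU : Realizes U π b F)
    (e : ι ↪ ι') {π' : β → ι'} {σ : α → β}
    (hπ' : Injective π') (hσ : Injective σ) (hcomm : ∀ a, e (π a) = π' (σ a))
    {b' : ι' → Bool} (hdisj : ∀ k, k ∉ Set.range π → e k ∉ Set.range π')
    (hb : ∀ k, k ∉ Set.range π → b' (e k) = b k) :
    Realizes (U.map (WiredGate.map e)) π' b' (act σ F) := fun ψ => by
  rw [run_map]
  exact act_pad hU (run_zero U) e.injective hπ' hσ hcomm hdisj hb ψ

theorem injective_extend_inl_inr {α ι ι' : Type} {π : α → ι} (hπ : Injective π) {f : α → ι'}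
    (hf : Injective f) : Injective (extend π (Sum.inl ∘ f) (Sum.inr : ι → ι' ⊕ ι)) := by
  intro i j h
  by_cases hi : ∃ a, π a = i <;> by_cases hj : ∃ a, π a = j
  · obtain ⟨a, rfl⟩ := hi
    obtain ⟨a', rfl⟩ := hj
    rw [hπ.extend_apply, hπ.extend_apply] at h
    rw [hf (Sum.inl_injective h)]
  · obtain ⟨a, rfl⟩ := hi
    rw [hπ.extend_apply, extend_apply' _ _ _ hj] at h
    simp at h
  · obtain ⟨a, rfl⟩ := hj
    rw [hπ.extend_apply, extend_apply' _ _ _ hi] at h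
    simp at h
  · rw [extend_apply' _ _ _ hj, extend_apply' _ _ _ hi] at h
    exact Sum.inr_injective h

/-- Attaching the register of a circuit to another register `ι'` along its data qubits. -/
noncomputable def attach {α ι ι' : Type} (π : α ↪ ι) (f : α ↪ ι') : ι ↪ ι' ⊕ ι :=
  ⟨_, injective_extend_inl_inr π.injective f.injective⟩

/-- The data qubits are glued to the given register and all other qubits go to a fresh summand, so
the program cannot clash with what is already there. Some labels of that summand stay idle, which is
harmless because only gates are counted. -/
theorem Realizes.attach {α β ι ι' : Type} {U : List (WiredGate ι)} {π : α ↪ ι} {b : ι → Bool}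
    {F : QState α → QState α} (hU : Realizes U π b F) (σ : α ↪ β) (τ : β ↪ ι')
    (b' : ι' → Bool) :
    Realizes (U.map (WiredGate.map (UniversalQC.attach π (σ.trans τ)))) (Sum.inl ∘ τ)
      (Sum.elim b' b) (act σ F) := by
  have h1 : ∀ k, k ∉ Set.range π → UniversalQC.attach π (σ.trans τ) k = Sum.inr k :=
    fun k hk => extend_apply' _ _ _ hk
  refine hU.map _ (Sum.inl_injective.comp τ.injective) σ.injective
    (fun a => π.injective.extend_apply _ _ a) (fun k hk => ?_) (fun k hk => ?_)
  · rw [h1 k hk]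
    simp
  · rw [h1 k hk]
    rfl

/-! ### Programmable families of maps -/

/-- A single circuit with at most `s` gates from `G` performs each map of the family `𝓕` on the
register `α`, the choice being made by the basis state of its other qubits. -/
def Programmable (G : Set Gate) {α : Type} (𝓕 : Set (QState α → QState α)) (s : ℕ) : Prop :=
  ∃ (ι : Type) (_ : Fintype ι) (π : α ↪ ι) (U : List (WiredGate ι)),
    (∀ p ∈ U, p.gate ∈ G) ∧ U.length ≤ s ∧ ∀ F ∈ 𝓕, ∃ b : ι → Bool, Realizes U π b F

theorem Programmable.mono {G : Set Gate} {α : Type} {𝓕 𝓕' : Set (QState α → QState α)}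
    {s s' : ℕ} (h : Programmable G 𝓕 s) (h𝓕 : 𝓕' ⊆ 𝓕) (hs : s ≤ s') : Programmable G 𝓕' s' := by
  obtain ⟨ι, i, π, U, hU, hl, hF⟩ := h
  exact ⟨ι, i, π, U, hU, hl.trans hs, fun F hF' => hF F (h𝓕 hF')⟩

theorem programmable_id (G : Set Gate) (α : Type) [Fintype α] :
    Programmable G {(id : QState α → QState α)} 0 :=
  ⟨α, inferInstance, Embedding.refl α, [], by simp, le_rfl, by
    rintro F rfl
    exact ⟨fun _ => false, fun ψ => rfl⟩⟩

/-- Each factor keeps its own program qubits and leaves the program of the other one untouched, so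
the two choices are independent and the sizes add. -/
theorem Programmable.comp {G : Set Gate} {α : Type} {𝓕 𝓕' : Set (QState α → QState α)}
    {s s' : ℕ} (h : Programmable G 𝓕 s) (h' : Programmable G 𝓕' s') :
    Programmable G (Set.image2 (fun F F' => F' ∘ F) 𝓕 𝓕') (s + s') := by
  obtain ⟨ι, i, π, U, hU, hl, hF⟩ := h
  obtain ⟨ι', i', π', U', hU', hl', hF'⟩ := h'
  refine ⟨ι ⊕ ι', inferInstance, π.trans Embedding.inl,
    U.map (WiredGate.map Embedding.inl) ++ U'.map (WiredGate.map (attach π' π)), ?_, ?_, ?_⟩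
  · intro p hp
    rcases List.mem_append.1 hp with hp | hp <;> obtain ⟨q, hq, rfl⟩ := List.mem_map.1 hp
    · exact hU q hq
    · exact hU' q hq
  · simp only [List.length_append, List.length_map]
    omega
  · rintro _ ⟨F, hFm, F', hFm', rfl⟩
    obtain ⟨b, hb⟩ := hF F hFm
    obtain ⟨b', hb'⟩ := hF' F' hFm'
    refine ⟨Sum.elim b b', Realizes.append ?_ ?_⟩
    · have := hb.map (Embedding.inl : ι ↪ ι ⊕ ι') (π' := Sum.inl ∘ π) (σ := id)
        (b' := Sum.elim b b') (Sum.inl_injective.comp π.injective) injective_id (fun a => rfl)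
        (fun k hk => by rintro ⟨a, ha⟩; exact hk ⟨a, Sum.inl_injective ha⟩) (fun k _ => rfl)
      rwa [act_id_map] at this
    · have := hb'.attach (Embedding.refl α) π b
      rw [Embedding.coe_refl, act_id_map] at this
      exact this

theorem Programmable.act {G : Set Gate} {α β : Type} [Fintype β]
    {𝓕 : Set (QState α → QState α)} {s : ℕ} (h : Programmable G 𝓕 s) (σ : α ↪ β) :
    Programmable G (act σ '' 𝓕) s := by
  obtain ⟨ι, i, π, U, hU, hl, hF⟩ := h
  refine ⟨β ⊕ ι, inferInstance, Embedding.inl, U.map (WiredGate.map (attach π σ)), ?_, ?_, ?_⟩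
  · intro p hp
    obtain ⟨q, hq, rfl⟩ := List.mem_map.1 hp
    exact hU q hq
  · simpa using hl
  · rintro _ ⟨F, hFm, rfl⟩
    obtain ⟨b, hb⟩ := hF F hFm
    exact ⟨Sum.elim (fun _ => false) b, hb.attach σ (Embedding.refl β) _⟩

/-- Fixing some qubits of the register to basis states that are given back. -/
theorem Programmable.fix {G : Set Gate} {α β : Type} {𝓕 : Set (QState β → QState β)} {s : ℕ}
    (h : Programmable G 𝓕 s) (ρ : α ↪ β) {𝓕' : Set (QState α → QState α)}
    (h𝓕 : ∀ F' ∈ 𝓕', ∃ F ∈ 𝓕, ∃ p : β → Bool, ∀ ψ, F (pad ρ p ψ) = pad ρ p (F' ψ)) :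
    Programmable G 𝓕' s := by
  obtain ⟨ι, i, π, U, hU, hl, hF⟩ := h
  refine ⟨ι, i, ρ.trans π, U, hU, hl, fun F' hF' => ?_⟩
  obtain ⟨F, hFm, p, hp⟩ := h𝓕 F' hF'
  obtain ⟨b, hb⟩ := hF F hFm
  refine ⟨extend π p b, fun ψ => ?_⟩
  have h1 := pad_comp π.injective (ρ := ρ) b p
  exact (congrArg (run U) (h1 ψ)).trans ((hb _).trans ((congrArg _ (hp ψ)).trans (h1 _).symm))

/-! ### Translation from matrices to maps on states -/

/-- A placed gate as a wired gate. -/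
def PlacedGate.wired {N : ℕ} (p : PlacedGate N) : WiredGate (Fin N) :=
  ⟨p.gate, p.wires, p.wires.injective⟩

/-- A wired gate on a standard register as a placed gate. -/
def WiredGate.placed {N : ℕ} (p : WiredGate (Fin N)) : PlacedGate N :=
  ⟨p.gate, ⟨p.wires, p.inj⟩⟩

/-- In the matrix product only the strings agreeing with `z'` off the wires contribute, and these
are parametrized by their values on the wires through `extend`. -/
theorem PlacedGate.toOp_mulVec {N : ℕ} (p : PlacedGate N) (ψ : State N) :
    p.toOp *ᵥ ψ = p.wired.apply ψ := by
  funext z'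
  have hinj : Injective (fun u => extend p.wires u z') := fun u v h => by
    funext k
    have := congrFun h (p.wires k)
    simpa [p.wires.injective.extend_apply] using this
  symm
  simp only [WiredGate.apply, act, Matrix.mulVec, dotProduct]
  refine Fintype.sum_of_injective _ hinj _ _ (fun z hz => ?_) (fun u => ?_)
  · unfold PlacedGate.toOp
    rw [if_neg, zero_mul]
    intro h
    refine hz ⟨z ∘ p.wires, ?_⟩
    funext i
    by_cases hi : ∃ k, p.wires k = i
    · obtain ⟨k, rfl⟩ := hi
      simp [p.wires.injective.extend_apply]
    · simp only
      rw [extend_apply' _ _ _ hi, h i (fun j hj => hi ⟨j, hj⟩)]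
  · unfold PlacedGate.toOp
    rw [if_pos]
    · have hu : (fun j => extend p.wires u z' (p.wires j)) = u :=
        funext fun j => p.wires.injective.extend_apply u z' j
      simp only [hu]
      rfl
    · intro i hi
      rw [extend_apply']
      rintro ⟨j, hj⟩
      exact hi j hj

theorem Circuit.toOp_mulVec {N : ℕ} (C : Circuit N) (ψ : State N) :
    Circuit.toOp C *ᵥ ψ = run (C.map PlacedGate.wired) ψ := by
  induction C generalizing ψ with
  | nil => exact Matrix.one_mulVec ψ
  | cons p C ih =>
    rw [Circuit.toOp, ← Matrix.mulVec_mulVec, ih, p.toOp_mulVec]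
    rfl

theorem map_wired_placed {N : ℕ} (C : List (WiredGate (Fin N))) :
    (C.map WiredGate.placed).map PlacedGate.wired = C := by
  rw [List.map_map]
  exact (List.map_congr_left fun p _ => rfl).trans (List.map_id C)

theorem tensor_ket {n m : ℕ} (ψ : State n) (x : Bits m) (b : Fin (n + m) → Bool)
    (hb : ∀ j, b (Fin.natAdd n j) = x j) :
    tensor ψ (ket x) = pad (Fin.castAdd m) b ψ := by
  classical
  funext z
  have hc : (fun j => z (Fin.natAdd n j)) = x ↔
      ∀ i, i ∉ Set.range (Fin.castAdd m) → z i = b i := by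
    constructor
    · rintro h i hi
      induction i using Fin.addCases with
      | left i => exact absurd ⟨i, rfl⟩ hi
      | right j => rw [hb, ← h]
    · intro h
      funext j
      rw [h, hb]
      rintro ⟨i, hi⟩
      have h1 := congrArg Fin.val hi
      simp only [Fin.val_castAdd, Fin.val_natAdd] at h1
      omega
  simp only [tensor, ket, pad, hc, mul_ite, mul_one, mul_zero]
  split_ifs <;> rfl

/-- Both sides are linear in `ψ`, and `Performs` is the identity on a basis. Superpositions matter
because the data are in general entangled when a subcircuit is used. -/
theorem mulVec_tensor_of_performs {n m : ℕ} {W : Circuit (n + m)} {x : Bits m} {A : Op n}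
    (h : W.Performs x A) (ψ : State n) :
    Circuit.toOp W *ᵥ tensor ψ (ket x) = tensor (A *ᵥ ψ) (ket x) := by
  let T : State n →ₗ[ℂ] State (n + m) :=
    { toFun := fun ψ => tensor ψ (ket x)
      map_add' := fun ψ φ => by
        funext z
        simp [tensor, add_mul]
      map_smul' := fun c ψ => by
        funext z
        simp [tensor, mul_assoc] }
  have hT : (Circuit.toOp W).mulVecLin ∘ₗ T = T ∘ₗ A.mulVecLin := by
    refine (Pi.basisFun ℂ (Bits n)).ext fun y => ?_
    have hy : (Pi.basisFun ℂ (Bits n)) y = ket y := by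
      funext z
      simp [ket, Pi.single_apply]
    rw [hy]
    exact h y
  exact LinearMap.congr_fun hT ψ

theorem realizes_of_performs {n m : ℕ} {W : Circuit (n + m)} {x : Bits m} {A : Op n}
    (h : W.Performs x A) (b : Fin (n + m) → Bool) (hb : ∀ j, b (Fin.natAdd n j) = x j) :
    Realizes (W.map PlacedGate.wired) (Fin.castAdd m) b (fun ψ => A *ᵥ ψ) := fun ψ => by
  rw [← tensor_ket ψ x b hb, ← Circuit.toOp_mulVec, mulVec_tensor_of_performs h,
    tensor_ket _ x b hb]

theorem programmable_of_implementable {G : Set Gate} {n : ℕ} {A : Op n}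
    (h : Implementable G A) : ∃ s, Programmable G {fun ψ : State n => A *ᵥ ψ} s := by
  obtain ⟨m, W, x, hW, hp⟩ := h
  refine ⟨W.length, Fin (n + m), inferInstance, Fin.castAddEmb m, W.map PlacedGate.wired, ?_,
    by simp, ?_⟩
  · intro p hp
    obtain ⟨q, hq, rfl⟩ := List.mem_map.1 hp
    exact hW q hq
  · rintro _ rfl
    exact ⟨Fin.append (fun _ => false) x, realizes_of_performs hp _ fun j => by simp⟩

/-! ### Optional gates and optional swaps -/

theorem controlled_mulVec_pad {w : ℕ} (A : Op w) (v : Bool) (ψ : State w) :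
    controlled A *ᵥ pad Fin.succ (fun _ => v) ψ =
      pad Fin.succ (fun _ => v) ((if v then A else 1) *ᵥ ψ) := by
  classical
  have hpad : ∀ (φ : State w) (z : Bits (w + 1)), pad Fin.succ (fun _ => v) φ z =
      if z 0 = v then φ (Fin.tail z) else 0 := by
    intro φ z
    have hc : (∀ i : Fin (w + 1), i ∉ Set.range Fin.succ → z i = v) ↔ z 0 = v := by
      simp [Fin.range_succ]
    simp only [pad, hc]
    rfl
  funext z'
  rw [hpad]
  simp only [Matrix.mulVec, dotProduct]
  rw [← Fintype.sum_of_injective (fun t : Bits w => (Fin.cons v t : Bits (w + 1)))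
    (Fin.cons_right_injective (α := fun _ => Bool) v)
    (fun t => if z' 0 = v then (if v then A else 1) (Fin.tail z') t * ψ t else 0)]
  · split_ifs <;> simp
  · intro z hz
    rw [hpad, if_neg, mul_zero]
    rintro h
    exact hz ⟨Fin.tail z, by rw [← h]; exact Fin.cons_self_tail z⟩
  · intro t
    rw [hpad]
    by_cases h : z' 0 = v <;> simp [controlled, h]

/-- The control qubit of the controlled gate joins the program: the value `false` gives the
identity, `true` gives the gate. -/
theorem programmable_gate {G : Set Gate} (hctrl : ClosedUnderControl G) {g : Gate} (hg : g ∈ G) :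
    ∃ s, Programmable G
      {id, fun ψ : State g.width => (g.op : Op g.width) *ᵥ ψ} s := by
  obtain ⟨s, hs⟩ := programmable_of_implementable (hctrl g hg)
  refine ⟨s, hs.fix (Fin.succEmb _) ?_⟩
  rintro F (rfl | rfl)
  · refine ⟨_, rfl, fun _ => false, fun ψ => ?_⟩
    have := controlled_mulVec_pad (g.op : Op g.width) false ψ
    simpa using this
  · refine ⟨_, rfl, fun _ => true, fun ψ => ?_⟩
    have := controlled_mulVec_pad (g.op : Op g.width) true ψ
    simpa using this

theorem programmable_wiredGate {G : Set Gate} {s : ℕ} {α : Type} [Fintype α] (p : WiredGate α)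
    (h : Programmable G {id, fun ψ : State p.gate.width => (p.gate.op : Op p.gate.width) *ᵥ ψ} s) :
    Programmable G {id, p.apply} s := by
  refine (h.act ⟨p.wires, p.inj⟩).mono ?_ le_rfl
  rintro F (rfl | rfl)
  · exact ⟨id, Or.inl rfl, act_id _⟩
  · exact ⟨_, Or.inr rfl, rfl⟩

/-- All gates of `C` are switched on together or off together. This makes an implementable operator
optional even when it is not itself a gate of `G`. -/
theorem programmable_run {G : Set Gate} (hctrl : ClosedUnderControl G) {α : Type} [Fintype α]
    (C : List (WiredGate α)) (hC : ∀ p ∈ C, p.gate ∈ G) :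
    ∃ s, Programmable G {id, run C} s := by
  induction C with
  | nil =>
    refine ⟨0, (programmable_id G α).mono ?_ le_rfl⟩
    rintro F (rfl | rfl) <;> rfl
  | cons p C ih =>
    obtain ⟨s, hs⟩ := ih fun q hq => hC q (List.mem_cons_of_mem _ hq)
    obtain ⟨t, ht⟩ := programmable_gate hctrl (hC p List.mem_cons_self)
    refine ⟨t + s, ((programmable_wiredGate p ht).comp hs).mono ?_ le_rfl⟩
    rintro F (rfl | rfl)
    · exact ⟨id, Or.inl rfl, id, Or.inl rfl, rfl⟩
    · exact ⟨p.apply, Or.inr rfl, run C, Or.inr rfl, rfl⟩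

/-- Relabelling the qubits of a state by a permutation. -/
def permute {α : Type} (P : Equiv.Perm α) (ψ : QState α) : QState α := fun z => ψ (z ∘ P)

theorem act_swapOp {α : Type} [DecidableEq α] {i j : α} (hij : i ≠ j) :
    act ![i, j] (fun ψ => swapOp *ᵥ ψ) = permute (Equiv.swap i j) := by
  funext ψ z
  have hinj : Injective ![i, j] := by
    intro a b
    fin_cases a <;> fin_cases b <;> simp [hij, hij.symm]
  simp only [act, permute, Matrix.mulVec, dotProduct]
  rw [Finset.sum_eq_single ![z j, z i]]
  · have h1 : swapOp (z ∘ ![i, j]) ![z j, z i] = 1 := by simp [swapOp]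
    rw [h1, one_mul]
    congr 1
    funext k
    by_cases hk : ∃ a, ![i, j] a = k
    · obtain ⟨a, rfl⟩ := hk
      rw [hinj.extend_apply]
      fin_cases a <;> simp
    · have h2 : k ≠ i := fun h => hk ⟨0, h.symm⟩
      have h3 : k ≠ j := fun h => hk ⟨1, h.symm⟩
      rw [extend_apply' _ _ _ hk, comp_apply, Equiv.swap_apply_of_ne_of_ne h2 h3]
  · intro u _ hu
    have h1 : swapOp (z ∘ ![i, j]) u = 0 := by
      unfold swapOp
      rw [if_neg]
      rintro ⟨h1, h2⟩
      apply hu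
      funext a
      fin_cases a
      · exact h2.symm
      · exact h1.symm
    rw [h1, zero_mul]
  · simp

/-- The ancillas of the circuit for the swap are absorbed into the program by `Programmable.fix`.
The bound `s` is chosen before the register, as later registers grow with `n` and `c`. -/
theorem programmable_swap {G : Set Gate} (hctrl : ClosedUnderControl G)
    (hswap : Implementable G swapOp) :
    ∃ s, ∀ (α : Type) [Fintype α] [DecidableEq α] (i j : α),
      Programmable G {id, permute (Equiv.swap i j)} s := by
  obtain ⟨m, W, x, hW, hp⟩ := hswap
  obtain ⟨s, hs⟩ := programmable_run hctrl (W.map PlacedGate.wired) (by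
    intro p hp
    obtain ⟨q, hq, rfl⟩ := List.mem_map.1 hp
    exact hW q hq)
  have h2 : Programmable G {id, fun ψ : State 2 => swapOp *ᵥ ψ} s := by
    refine hs.fix (Fin.castAddEmb m) ?_
    rintro F (rfl | rfl)
    · exact ⟨id, Or.inl rfl, fun _ => false, fun ψ => rfl⟩
    · exact ⟨_, Or.inr rfl, Fin.append (fun _ => false) x,
        realizes_of_performs hp _ fun j => by simp⟩
  refine ⟨s, fun α _ _ i j => ?_⟩
  by_cases hij : i = j
  · subst hij
    refine (programmable_id G α).mono ?_ (Nat.zero_le _)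
    rintro F (rfl | rfl)
    · rfl
    · rw [Equiv.swap_self]
      rfl
  · have hinj : Injective ![i, j] := by
      intro a b
      fin_cases a <;> fin_cases b <;> simp [hij, Ne.symm hij]
    refine (h2.act ⟨_, hinj⟩).mono ?_ le_rfl
    rintro F (rfl | rfl)
    · exact ⟨id, Or.inl rfl, act_id _⟩
    · exact ⟨_, Or.inr rfl, act_swapOp hij⟩

/-! ### Sequences of optional moves -/

/-- The optional steps of a programmable circuit: swapping two qubits or applying a gate. -/
inductive Move (α : Type) where
  | swap (i j : α)
  | gate (p : WiredGate α)

open Classical in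
/-- The action of a move on states. -/
noncomputable def Move.apply {α : Type} : Move α → QState α → QState α
  | .swap i j => permute (Equiv.swap i j)
  | .gate p => p.apply

/-- The gate of a move, if there is one, is drawn from `G`. -/
def Move.IsOver {α : Type} (G : Set Gate) : Move α → Prop
  | .swap _ _ => True
  | .gate p => p.gate ∈ G

/-- The action of a sequence of moves, first move first. -/
noncomputable def runMoves {α : Type} : List (Move α) → QState α → QState α
  | [], ψ => ψ
  | M :: L, ψ => runMoves L (M.apply ψ)

theorem runMoves_append {α : Type} (L L' : List (Move α)) (ψ : QState α) :
    runMoves (L ++ L') ψ = runMoves L' (runMoves L ψ) := by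
  induction L generalizing ψ with
  | nil => rfl
  | cons M L ih => exact ih _

/-- Finiteness of `G` enters here: the costs of its optional gates have a common bound. -/
theorem exists_programmable_move {G : Set Gate} (hfin : G.Finite) (hctrl : ClosedUnderControl G)
    (hswap : Implementable G swapOp) :
    ∃ K, ∀ (α : Type) [Fintype α] (M : Move α), M.IsOver G → Programmable G {id, M.apply} K := by
  classical
  obtain ⟨s, hs⟩ := programmable_swap hctrl hswap
  have h1 : ∀ g : Gate, ∃ t, g ∈ G → Programmable G
      {id, fun ψ : State g.width => (g.op : Op g.width) *ᵥ ψ} t := fun g => by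
    by_cases hg : g ∈ G
    · obtain ⟨t, ht⟩ := programmable_gate hctrl hg
      exact ⟨t, fun _ => ht⟩
    · exact ⟨0, fun h => absurd h hg⟩
  choose f hf using h1
  obtain ⟨B, hB⟩ := (hfin.image f).bddAbove
  refine ⟨max s B, fun α _ M hM => ?_⟩
  cases M with
  | swap i j => exact (hs α i j).mono le_rfl (le_max_left _ _)
  | gate p =>
    exact (programmable_wiredGate p (hf _ hM)).mono le_rfl
      ((hB ⟨_, hM, rfl⟩).trans (le_max_right _ _))

theorem programmable_sublists {G : Set Gate} {K : ℕ} {α : Type} [Fintype α]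
    (hK : ∀ M : Move α, M.IsOver G → Programmable G {id, M.apply} K) (L : List (Move α))
    (hL : ∀ M ∈ L, M.IsOver G) :
    Programmable G {F | ∃ L', L'.Sublist L ∧ runMoves L' = F} (K * L.length) := by
  induction L with
  | nil =>
    refine (programmable_id G α).mono ?_ (Nat.zero_le _)
    rintro F ⟨L', h, rfl⟩
    rw [List.sublist_nil.1 h]
    rfl
  | cons M L ih =>
    refine ((hK M (hL M List.mem_cons_self)).comp
      (ih fun M' h => hL M' (List.mem_cons_of_mem _ h))).mono ?_ ?_
    · rintro F ⟨L', h, rfl⟩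
      cases h with
      | cons _ h => exact ⟨id, Or.inl rfl, _, ⟨_, h, rfl⟩, rfl⟩
      | cons_cons _ h => exact ⟨M.apply, Or.inr rfl, _, ⟨_, h, rfl⟩, rfl⟩
    · rw [List.length_cons]
      exact le_of_eq (by ring)

/-- The data qubits are numbered first and the register of the circuit follows as encoding qubits,
whose values are read off from the program. -/
theorem Programmable.exists_circuit {G : Set Gate} {n : ℕ} {𝓕 : Set (State n → State n)} {s : ℕ}
    (h : Programmable G 𝓕 s) :
    ∃ (m : ℕ) (U : Circuit (n + m)), U.IsOver G ∧ U.size ≤ s ∧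
      ∀ A : Op n, (fun ψ => A *ᵥ ψ) ∈ 𝓕 → ∃ x : Bits m, U.Performs x A := by
  obtain ⟨ι, i, π, U, hU, hl, hF⟩ := h
  let e : Fin n ⊕ ι ≃ Fin (n + Fintype.card ι) :=
    (Equiv.sumCongr (Equiv.refl _) (Fintype.equivFin ι)).trans finSumFinEquiv
  refine ⟨Fintype.card ι, (U.map (WiredGate.map
    ((attach π (Embedding.refl (Fin n))).trans e.toEmbedding))).map WiredGate.placed, ?_, ?_, ?_⟩
  · intro p hp
    obtain ⟨q, hq, rfl⟩ := List.mem_map.1 hp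
    obtain ⟨r, hr, rfl⟩ := List.mem_map.1 hq
    exact hU r hr
  · simpa [Circuit.size] using hl
  · intro A hA
    obtain ⟨b, hb⟩ := hF _ hA
    refine ⟨fun j => b ((Fintype.equivFin ι).symm j), fun y => ?_⟩
    have h1 : ∀ k, k ∉ Set.range π → attach π (Embedding.refl (Fin n)) k = Sum.inr k :=
      fun k hk => extend_apply' _ _ _ hk
    have h2 : ∀ j, Fin.append (fun _ : Fin n => false)
        (fun j => b ((Fintype.equivFin ι).symm j)) (Fin.natAdd n j) =
        b ((Fintype.equivFin ι).symm j) := fun j => by simp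
    have h3 : ∀ k, e (Sum.inr k) = Fin.natAdd n (Fintype.equivFin ι k) := fun k => rfl
    have h4 : ∀ k, e (Sum.inl k) = Fin.castAdd _ k := fun k => rfl
    have := hb.map ((attach π (Embedding.refl (Fin n))).trans e.toEmbedding)
      (π' := Fin.castAdd (Fintype.card ι)) (σ := id)
      (b' := Fin.append (fun _ : Fin n => false) (fun j => b ((Fintype.equivFin ι).symm j)))
      (Fin.castAdd_injective _ _) injective_id
      (fun a => by
        change e (attach π (Embedding.refl (Fin n)) (π a)) = _
        rw [← h4]
        exact congrArg e (π.injective.extend_apply _ _ a))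
      (fun k hk => by
        change e (attach π (Embedding.refl (Fin n)) k) ∉ _
        rw [h1 k hk]
        rintro ⟨a, ha⟩
        rw [← h4] at ha
        exact Sum.inl_ne_inr (e.injective ha))
      (fun k hk => by
        change Fin.append _ _ (e (attach π (Embedding.refl (Fin n)) k)) = _
        rw [h1 k hk, h3, h2, Equiv.symm_apply_apply])
    rw [act_id_map] at this
    rw [Circuit.toOp_mulVec, map_wired_placed, tensor_ket _ _ _ h2, tensor_ket _ _ _ h2]
    exact this _

/-! ### Two-colourings -/

/-- Two involutions without fixed points have a common two-colouring. -/
theorem exists_two_coloring {X : Type} (α β : Equiv.Perm X) (hα : ∀ x, α (α x) = x)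
    (hα' : ∀ x, α x ≠ x) (hβ : ∀ x, β (β x) = x) (hβ' : ∀ x, β x ≠ x) :
    ∃ c : X → Bool, (∀ x, c (α x) = !c x) ∧ ∀ x, c (β x) = !c x := by
  classical
  -- Both involutions conjugate `γ` to its inverse, and `α x`, `β x` lie in the same `γ`-cycle. So
  -- it suffices to colour `γ`-cycles such that the involution induced by `α` on them changes the
  -- colour.
  set γ : Equiv.Perm X := α * β with hγ
  have hconj1 : ∀ x, α (γ x) = γ⁻¹ (α x) := fun x => by
    rw [Equiv.Perm.eq_inv_iff_eq]
    simp [hγ, hα, hβ]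
  have hconj : ∀ (k : ℤ) x, α ((γ ^ k) x) = (γ ^ (-k)) (α x) := by
    intro k x
    have h1 : α * γ * α⁻¹ = γ⁻¹ := by
      ext y
      rw [Equiv.Perm.mul_apply, Equiv.Perm.mul_apply, hconj1, ← Equiv.Perm.mul_apply α,
        mul_inv_cancel, Equiv.Perm.one_apply]
    have h2 : α * γ ^ k * α⁻¹ = γ ^ (-k) := by
      rw [← conj_zpow, h1, inv_zpow, zpow_neg]
    rw [← h2]
    simp
  -- If `α x = γ ^ k x`, then the midpoint `γ ^ m x` is a fixed point of `α` when `k = 2 * m` and of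
  -- `β` when `k = 2 * m + 1`.
  have hne : ∀ x, ¬ γ.SameCycle x (α x) := by
    rintro x ⟨k, hk⟩
    rcases Int.even_or_odd' k with ⟨m, rfl | rfl⟩
    · apply hα' ((γ ^ m) x)
      rw [hconj, ← hk, ← Equiv.Perm.mul_apply, ← zpow_add]
      congr 2
      ring
    · apply hβ' ((γ ^ m) x)
      apply α.injective
      rw [← Equiv.Perm.mul_apply α β, ← hγ, hconj, ← hk, ← Equiv.Perm.mul_apply,
        ← Equiv.Perm.mul_apply, ← zpow_add, ← zpow_one_add]
      congr 2
      ring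
  let r : X → X := fun x => (Quotient.mk (Equiv.Perm.SameCycle.setoid γ) x).out
  have hr : ∀ x y, r x = r y ↔ γ.SameCycle x y := fun x y => by
    simp only [r, Quotient.out_inj]
    exact Quotient.eq
  -- A well-order on cycle representatives breaks the symmetry between the two cycles exchanged by
  -- `α`.
  have hflip : ∀ x y, r x ≠ r y →
      decide (WellOrderingRel (r y) (r x)) = !decide (WellOrderingRel (r x) (r y)) := by
    intro x y h
    rcases trichotomous_of WellOrderingRel (r x) (r y) with h1 | h1 | h1
    · simp [h1, asymm_of WellOrderingRel h1]
    · exact absurd h1 h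
    · simp [h1, asymm_of WellOrderingRel h1]
  have hβr : ∀ x, r (β x) = r (α x) := fun x => by
    rw [hr]
    exact ⟨1, by simp [hγ, hβ]⟩
  have hαβr : ∀ x, r (α (β x)) = r x := fun x => by
    rw [eq_comm, hr]
    exact ⟨1, by simp [hγ]⟩
  refine ⟨fun x => decide (WellOrderingRel (r x) (r (α x))), fun x => ?_, fun x => ?_⟩
  · simp only [hα]
    exact hflip _ _ fun h => hne x ((hr _ _).1 h)
  · simp only [hβr, hαβr]
    exact hflip _ _ fun h => hne x ((hr _ _).1 h)

/-- The other member of the pair `{2 j, 2 j + 1}`. -/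
def partner (t : ℕ) : ℕ := if t % 2 = 0 then t + 1 else t - 1

theorem partner_partner (t : ℕ) : partner (partner t) = t := by
  unfold partner
  split_ifs <;> omega

theorem partner_ne (t : ℕ) : partner t ≠ t := by
  unfold partner
  split_ifs <;> omega

/-- The arcs of a permutation of `ℕ` can be coloured with two colours such that the arcs leaving
a pair `{2 j, 2 j + 1}`, and likewise those entering it, have different colours. -/
theorem exists_arc_coloring (ρ : Equiv.Perm ℕ) :
    ∃ c : ℕ → Bool, (∀ t, c (partner t) = !c t) ∧
      ∀ t, c (ρ.symm (partner t)) = !c (ρ.symm t) := by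
  have hinv : Involutive partner := partner_partner
  -- An arc is named by its source. The first involution pairs arcs leaving a common pair, the
  -- second, the conjugate of `partner` by `ρ`, pairs arcs entering a common pair.
  obtain ⟨c, h1, h2⟩ := exists_two_coloring (hinv.toPerm partner)
    ((ρ.trans (hinv.toPerm partner)).trans ρ.symm)
    partner_partner partner_ne
    (fun x => by simp [partner_partner])
    (fun x h => by
      apply partner_ne (ρ x)
      have := congrArg ρ h
      simpa using this)
  refine ⟨c, h1, fun t => ?_⟩
  have := h2 (ρ.symm t)
  simpa using this

/-! ### The switching network -/

/-- The permutation effected by a sequence of switches, first switch first. -/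
def switchPerm {Q : Type} [DecidableEq Q] : List (Q × Q) → Equiv.Perm Q
  | [] => 1
  | s :: L => switchPerm L * Equiv.swap s.1 s.2

theorem switchPerm_append {Q : Type} [DecidableEq Q] (L L' : List (Q × Q)) :
    switchPerm (L ++ L') = switchPerm L' * switchPerm L := by
  induction L with
  | nil => rfl
  | cons s L ih => rw [List.cons_append, switchPerm, ih, switchPerm, mul_assoc]

/-- Between the holes `t`, at which the wire is on position `q`, and `t'`, the permutations `σ`
take the wire to the position `o` for the first time at `t'`. -/
inductive FirstArrival {Q : Type} (σ : ℕ → Equiv.Perm Q) (o : Q) : ℕ → Q → ℕ → Prop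
  | arrive {t : ℕ} {q : Q} : σ (t + 1) q = o → FirstArrival σ o t q (t + 1)
  | step {t t' : ℕ} {q : Q} : σ (t + 1) q ≠ o → FirstArrival σ o (t + 1) (σ (t + 1) q) t' →
      FirstArrival σ o t q t'

theorem FirstArrival.lt {Q : Type} {σ : ℕ → Equiv.Perm Q} {o : Q} {t t' : ℕ} {q : Q}
    (h : FirstArrival σ o t q t') : t < t' := by
  induction h with
  | arrive => omega
  | step _ _ ih => omega

theorem FirstArrival.eq_of_succ {Q : Type} {σ : ℕ → Equiv.Perm Q} {o : Q} {t : ℕ} {q : Q}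
    (h : FirstArrival σ o t q (t + 1)) : σ (t + 1) q = o := by
  cases h with
  | arrive h => exact h
  | step _ h => exact absurd h.lt (lt_irrefl _)

theorem FirstArrival.tail {Q : Type} {σ : ℕ → Equiv.Perm Q} {o : Q} {t t' : ℕ} {q : Q}
    (h : FirstArrival σ o t q t') (ht : t' ≠ t + 1) :
    σ (t + 1) q ≠ o ∧ FirstArrival σ o (t + 1) (σ (t + 1) q) t' := by
  cases h with
  | arrive h => exact absurd rfl ht
  | step h h' => exact ⟨h, h'⟩

/-- The copy with label `ε` of a sequence of switches. -/
def copySwitches {Q : Type} (ε : Bool) (L : List (Q × Q)) : List ((Q × Bool) × (Q × Bool)) :=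
  L.map fun s => ((s.1, ε), (s.2, ε))

theorem switchPerm_copySwitches_same {Q : Type} [DecidableEq Q] (ε : Bool) (L : List (Q × Q))
    (q : Q) : switchPerm (copySwitches ε L) (q, ε) = (switchPerm L q, ε) := by
  induction L generalizing q with
  | nil => rfl
  | cons s L ih =>
    have h : Equiv.swap (s.1, ε) (s.2, ε) (q, ε) = (Equiv.swap s.1 s.2 q, ε) := by
      simp only [Equiv.swap_apply_def, Prod.mk.injEq, and_true]
      split_ifs <;> rfl
    change switchPerm (copySwitches ε L) (Equiv.swap (s.1, ε) (s.2, ε) (q, ε)) = _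
    rw [h, ih]
    rfl

theorem switchPerm_copySwitches_ne {Q : Type} [DecidableEq Q] {ε δ : Bool} (h : δ ≠ ε)
    (L : List (Q × Q)) (q : Q) : switchPerm (copySwitches ε L) (q, δ) = (q, δ) := by
  induction L with
  | nil => rfl
  | cons s L ih =>
    have h : Equiv.swap (s.1, ε) (s.2, ε) (q, δ) = (q, δ) :=
      Equiv.swap_apply_of_ne_of_ne (fun h' => h (Prod.ext_iff.1 h').2)
        (fun h' => h (Prod.ext_iff.1 h').2)
    change switchPerm (copySwitches ε L) (Equiv.swap (s.1, ε) (s.2, ε) (q, δ)) = _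
    rw [h, ih]

/-- An optional switch between the positions `(o, false)` and `(o, true)`. -/
def optSwitch {Q : Type} (o : Q) (b : Bool) : List ((Q × Bool) × (Q × Bool)) :=
  if b then [((o, false), (o, true))] else []

theorem optSwitch_sublist {Q : Type} (o : Q) (b : Bool) :
    (optSwitch o b).Sublist [((o, false), (o, true))] := by
  cases b
  · exact List.nil_sublist _
  · exact List.Sublist.refl _

theorem switchPerm_optSwitch {Q : Type} [DecidableEq Q] (o : Q) (b δ : Bool) :
    switchPerm (optSwitch o b) (o, δ) = (o, xor δ b) := by
  cases b <;> cases δ <;> simp [optSwitch, switchPerm]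

theorem switchPerm_optSwitch_ne {Q : Type} [DecidableEq Q] {o q : Q} (h : q ≠ o) (b δ : Bool) :
    switchPerm (optSwitch o b) (q, δ) = (q, δ) := by
  cases b
  · rfl
  · exact Equiv.swap_apply_of_ne_of_ne (fun h' => h (Prod.ext_iff.1 h').1)
      (fun h' => h (Prod.ext_iff.1 h').1)

theorem sum_range_two_mul (f : ℕ → ℕ) (n : ℕ) :
    ∑ t ∈ Finset.range (2 * n), f t =
      ∑ j ∈ Finset.range n, (f (2 * j) + f (2 * j + 1)) := by
  induction n with
  | zero => rfl
  | succ n ih =>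
    rw [Nat.mul_succ, Finset.sum_range_succ, Finset.sum_range_succ, ih, Finset.sum_range_succ]
    omega

/-- The member of the pair `{2 j, 2 j + 1}` with colour `ε`. -/
def ofColor (c : ℕ → Bool) (ε : Bool) (j : ℕ) : ℕ := if c (2 * j) = ε then 2 * j else 2 * j + 1

theorem ofColor_div (c : ℕ → Bool) (ε : Bool) (j : ℕ) : ofColor c ε j / 2 = j := by
  unfold ofColor
  split_ifs <;> omega

theorem color_odd {c : ℕ → Bool} (hc : ∀ t, c (partner t) = !c t) (j : ℕ) :
    c (2 * j + 1) = !c (2 * j) := by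
  rw [← hc]
  simp [partner]

theorem color_ofColor {c : ℕ → Bool} (hc : ∀ t, c (partner t) = !c t) (ε : Bool) (j : ℕ) :
    c (ofColor c ε j) = ε := by
  unfold ofColor
  split_ifs with h
  · exact h
  · rw [color_odd hc]
    exact (Bool.eq_not_of_ne fun h' => h h'.symm).symm

theorem ofColor_eq {c : ℕ → Bool} (hc : ∀ t, c (partner t) = !c t) (t : ℕ) :
    ofColor c (c t) (t / 2) = t := by
  unfold ofColor
  rcases Nat.even_or_odd' t with ⟨j, rfl | rfl⟩
  · simp
  · have h : (2 * j + 1) / 2 = j := by omega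
    rw [h, color_odd hc]
    simp

/-- The arcs of colour `ε` of a permutation of `ℕ`, as a permutation of the pairs. -/
def colorPerm (ρ : Equiv.Perm ℕ) {c : ℕ → Bool} (hc : ∀ t, c (partner t) = !c t)
    (hc' : ∀ t, c (ρ.symm (partner t)) = !c (ρ.symm t)) (ε : Bool) : Equiv.Perm ℕ where
  toFun j := ρ (ofColor c ε j) / 2
  invFun k := ρ.symm (ofColor (c ∘ ρ.symm) ε k) / 2
  left_inv j := by
    have h1 : (c ∘ ρ.symm) (ρ (ofColor c ε j)) = ε := by
      simp [color_ofColor hc]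
    have h2 := ofColor_eq (c := c ∘ ρ.symm) hc' (ρ (ofColor c ε j))
    rw [h1] at h2
    simp only
    rw [h2, Equiv.symm_apply_apply, ofColor_div]
  right_inv k := by
    have h1 : c (ρ.symm (ofColor (c ∘ ρ.symm) ε k)) = ε :=
      color_ofColor (c := c ∘ ρ.symm) hc' ε k
    have h2 := ofColor_eq hc (ρ.symm (ofColor (c ∘ ρ.symm) ε k))
    rw [h1] at h2
    simp only
    rw [h2, Equiv.apply_symm_apply, ofColor_div]

/-- The hole `t` is the member of colour `c t` in its pair, so the copy labelled `c t` is the one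
responsible for the arc from `t` to `ρ t`. -/
theorem colorPerm_apply (ρ : Equiv.Perm ℕ) {c : ℕ → Bool} (hc : ∀ t, c (partner t) = !c t)
    (hc' : ∀ t, c (ρ.symm (partner t)) = !c (ρ.symm t)) (t : ℕ) :
    colorPerm ρ hc hc' (c t) (t / 2) = ρ t / 2 := by
  change ρ (ofColor c (c t) (t / 2)) / 2 = _
  rw [ofColor_eq hc]

/-- The layers of the network that is made of two copies of the network `L`, with three more
switches for each pair of holes. -/
def doubleLayers {Q : Type} (o : Q) (L : ℕ → List (Q × Q)) (t : ℕ) :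
    List ((Q × Bool) × (Q × Bool)) :=
  if t % 2 = 0 then
    [((o, false), (o, true))] ++ (copySwitches false (L (t / 2)) ++
      (copySwitches true (L (t / 2)) ++ [((o, false), (o, true))]))
  else [((o, false), (o, true))]

/-- The settings of the doubled network that follow the arcs of `ρ`, coloured by `c`. -/
def doubleSettings {Q : Type} (o : Q) (S : Bool → ℕ → List (Q × Q)) (ρ : Equiv.Perm ℕ)
    (c : ℕ → Bool) (t : ℕ) : List ((Q × Bool) × (Q × Bool)) :=
  if t % 2 = 0 then
    optSwitch o (c (t - 1)) ++ (copySwitches false (S false (t / 2)) ++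
      (copySwitches true (S true (t / 2)) ++ optSwitch o (c (ρ.symm t))))
  else optSwitch o (decide (ρ (t - 1) ≠ t))

theorem doubleSettings_sublist {Q : Type} {o : Q} {S : Bool → ℕ → List (Q × Q)}
    {L : ℕ → List (Q × Q)} (h : ∀ ε t, (S ε t).Sublist (L t)) (ρ : Equiv.Perm ℕ) (c : ℕ → Bool)
    (t : ℕ) : (doubleSettings o S ρ c t).Sublist (doubleLayers o L t) := by
  unfold doubleSettings doubleLayers
  split_ifs
  · exact (optSwitch_sublist _ _).append (((h false _).map _).append
      (((h true _).map _).append (optSwitch_sublist _ _)))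
  · exact optSwitch_sublist _ _

/-- The passage between two pairs of holes: the first switch, recorded in `hy`, selects the copy
`ε`; the layer of that copy acts; the last switch decides which copy's wire reaches the even hole.
-/
theorem doubleSettings_even {Q : Type} [DecidableEq Q] (o : Q) (S : Bool → ℕ → List (Q × Q))
    (ρ : Equiv.Perm ℕ) (c : ℕ → Bool) (j : ℕ) {y : Q × Bool} {q : Q} {ε : Bool}
    (hy : switchPerm (optSwitch o (c (2 * j + 1))) y = (q, ε)) :
    switchPerm (doubleSettings o S ρ c (2 * j + 1 + 1)) y =
      switchPerm (optSwitch o (c (ρ.symm (2 * j + 2)))) (switchPerm (S ε (j + 1)) q, ε) := by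
  have h1 : (2 * j + 1 + 1) % 2 = 0 := by omega
  have h2 : (2 * j + 1 + 1) / 2 = j + 1 := by omega
  rw [doubleSettings, if_pos h1, h2, switchPerm_append, switchPerm_append, switchPerm_append,
    Nat.add_sub_cancel, Equiv.Perm.mul_apply, Equiv.Perm.mul_apply, Equiv.Perm.mul_apply, hy]
  cases ε
  · rw [switchPerm_copySwitches_same, switchPerm_copySwitches_ne (by decide)]
  · rw [switchPerm_copySwitches_ne (ε := false) (δ := true) (fun h => Bool.noConfusion h), switchPerm_copySwitches_same]

theorem doubleSettings_odd {Q : Type} (o : Q) (S : Bool → ℕ → List (Q × Q))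
    (ρ : Equiv.Perm ℕ) (c : ℕ → Bool) (j : ℕ) :
    doubleSettings o S ρ c (2 * j + 1) = optSwitch o (decide (ρ (2 * j) ≠ 2 * j + 1)) := by
  have h1 : ¬ (2 * j + 1) % 2 = 0 := by omega
  rw [doubleSettings, if_neg h1, Nat.add_sub_cancel]

/-- A journey in the copy `ε` lifts to one in the doubled network. As long as it avoids `o` in the
copy, the extra switches do not touch it. On arrival at its pair it is either switched to `(o,
false)` for the even hole, or waits at `(o, true)` and is switched in just before the odd one. -/
theorem firstArrival_double {Q : Type} [DecidableEq Q] {o : Q} {S : Bool → ℕ → List (Q × Q)}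
    {ρ : Equiv.Perm ℕ} {c : ℕ → Bool}
    (hc' : ∀ t, c (ρ.symm (partner t)) = !c (ρ.symm t)) {ε : Bool} {j j' : ℕ} {q : Q}
    (h : FirstArrival (fun k => switchPerm (S ε k)) o j q j') {t' : ℕ} (ht' : t' / 2 = j')
    (hε : c (ρ.symm t') = ε) (hρ : t' = 2 * j' + 1 → ρ (2 * j') ≠ 2 * j' + 1) {y : Q × Bool}
    (hy : switchPerm (optSwitch o (c (2 * j + 1))) y = (q, ε)) :
    FirstArrival (fun k => switchPerm (doubleSettings o S ρ c k)) (o, false)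
      (2 * j + 1) y t' := by
  induction h generalizing y with
  | @arrive j q h =>
    have h1 := doubleSettings_even o S ρ c j hy
    rw [h, switchPerm_optSwitch] at h1
    have h2 : t' = 2 * j + 2 ∨ t' = 2 * (j + 1) + 1 := by omega
    rcases h2 with rfl | rfl
    · refine .arrive (h1.trans ?_)
      rw [hε, Bool.xor_self]
    · have h3 : c (ρ.symm (2 * j + 2)) = !ε := by
        have := color_odd (c := c ∘ ρ.symm) hc' (j + 1)
        rw [comp_apply, hε] at this
        rw [this, Bool.not_not]
        rfl
      rw [h3, Bool.xor_not_self] at h1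
      refine .step (fun h4 => ?_) (.arrive ?_)
      · rw [h1] at h4
        simp at h4
      · rw [h1]
        have h5 := doubleSettings_odd o S ρ c (j + 1)
        rw [show 2 * j + 1 + 1 + 1 = 2 * (j + 1) + 1 by ring, h5, switchPerm_optSwitch]
        simp [hρ rfl]
  | @step j j' q h _ ih =>
    have h1 := doubleSettings_even o S ρ c j hy
    rw [switchPerm_optSwitch_ne h] at h1
    have h6 : switchPerm (doubleSettings o S ρ c (2 * j + 1 + 1 + 1))
        (switchPerm (S ε (j + 1)) q, ε) = (switchPerm (S ε (j + 1)) q, ε) := by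
      have h5 := doubleSettings_odd o S ρ c (j + 1)
      rw [show 2 * j + 1 + 1 + 1 = 2 * (j + 1) + 1 by ring, h5, switchPerm_optSwitch_ne h]
    have hne : (switchPerm (S ε (j + 1)) q, ε) ≠ (o, false) := fun h' => h (Prod.ext_iff.1 h').1
    refine .step ?_ (.step ?_ ?_)
    · rw [h1]
      exact hne
    · rw [h1, h6]
      exact hne
    · rw [h1, h6]
      exact ih ht' hρ (switchPerm_optSwitch_ne h _ _)

/-- A network of `O(N log N)` switches with `N = 2 ^ d` holes at the position `o` such that, for
each permutation `ρ` of the holes, the switches can be set so that the wire leaving a hole `t`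
comes back to `o` for the first time at the hole `ρ t`, provided that this hole is later. -/
theorem exists_network (d : ℕ) :
    ∃ (Q : Type) (_ : Fintype Q) (_ : DecidableEq Q) (o : Q) (L : ℕ → List (Q × Q)),
      ∑ t ∈ Finset.range (2 ^ d), (L t).length ≤ 3 * d * 2 ^ d ∧
      ∀ ρ : Equiv.Perm ℕ, ∃ S : ℕ → List (Q × Q), (∀ t, (S t).Sublist (L t)) ∧
        ∀ t, t < ρ t → ρ t < 2 ^ d →
          FirstArrival (fun k => switchPerm (S k)) o t o (ρ t) := by
  induction d with
  | zero =>
    refine ⟨Unit, inferInstance, inferInstance, (), fun _ => [], by simp, fun ρ =>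
      ⟨fun _ => [], fun _ => List.Sublist.refl _, fun t h h' => ?_⟩⟩
    omega
  | succ d ih =>
    obtain ⟨Q, i1, i2, o, L, hL, hρ⟩ := ih
    refine ⟨Q × Bool, inferInstance, inferInstance, (o, false), doubleLayers o L, ?_, ?_⟩
    · have h1 : ∀ j, (doubleLayers o L (2 * j)).length + (doubleLayers o L (2 * j + 1)).length =
          2 * (L j).length + 3 := by
        intro j
        have h1 : ¬ (2 * j + 1) % 2 = 0 := by omega
        have h2 : (2 * j) % 2 = 0 := by omega
        have h3 : (2 * j) / 2 = j := by omega
        simp only [doubleLayers, if_pos h2, if_neg h1, h3, List.length_append, copySwitches,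
          List.length_map, List.length_singleton]
        ring
      rw [pow_succ', sum_range_two_mul]
      simp only [h1]
      rw [Finset.sum_add_distrib, ← Finset.mul_sum]
      simp only [Finset.sum_const, Finset.card_range, smul_eq_mul]
      nlinarith [Nat.zero_le (2 ^ d)]
    · intro ρ
      obtain ⟨c, hc, hc'⟩ := exists_arc_coloring ρ
      -- Each copy routes the arcs of its own colour.
      have h1 := fun ε => hρ (colorPerm ρ hc hc' ε)
      choose S hS hS' using h1
      refine ⟨doubleSettings o S ρ c, doubleSettings_sublist hS ρ c, fun t ht ht2 => ?_⟩
      -- An arc within a pair goes from its even to its odd hole and does not enter the copies: the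
      -- middle switch is left open and the wire stays at `(o, false)`.
      by_cases hj : t / 2 = ρ t / 2
      · have h2 : t = 2 * (t / 2) := by omega
        have h3 : ρ t = t + 1 := by omega
        rw [h3]
        refine .arrive ?_
        have h4 := doubleSettings_odd o S ρ c (t / 2)
        rw [← h2, h3] at h4
        simp [h4, switchPerm_optSwitch]
      · have h2 := colorPerm_apply ρ hc hc' t
        have h3 : t / 2 < ρ t / 2 := by omega
        have h4 : ρ t / 2 < 2 ^ d := by
          rw [pow_succ'] at ht2
          omega
        have h5 := hS' (c t) (t / 2) (by rw [h2]; exact h3) (by rw [h2]; exact h4)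
        rw [h2] at h5
        have h6 : ρ t = 2 * (ρ t / 2) + 1 → ρ (2 * (ρ t / 2)) ≠ 2 * (ρ t / 2) + 1 := by
          intro h h'
          rw [← h] at h'
          have := ρ.injective h'
          omega
        have h7 := fun y => firstArrival_double hc' h5 rfl (by simp) h6 (y := y)
        -- A wire leaving the even hole is first moved to `(o, true)`, which clears `(o, false)` for
        -- the odd hole. Since the colours in a pair differ, the switch set by `c (2 * j + 1)` then
        -- sends both wires to the right copies.
        rcases Nat.even_or_odd' t with ⟨j, hj' | hj'⟩
        · have hjj : t / 2 = j := by omega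
          rw [hjj] at h7
          have h8 := h7 (o, true) (by
            rw [switchPerm_optSwitch, color_odd hc, hj']
            simp)
          have h9 : switchPerm (doubleSettings o S ρ c (t + 1)) (o, false) = (o, true) := by
            have h4 := doubleSettings_odd o S ρ c j
            rw [← hj'] at h4
            have h10 : ρ t ≠ t + 1 := by omega
            simp [h4, switchPerm_optSwitch, h10]
          refine .step ?_ ?_
          · rw [h9]
            simp
          · rw [h9, hj']
            rw [hj'] at h8
            exact h8
        · have hjj : t / 2 = j := by omega
          rw [hjj] at h7
          have h8 := h7 (o, false) (by
            rw [switchPerm_optSwitch, hj']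
            simp)
          rw [← hj'] at h8
          exact h8

/-! ### Routing tokens from hole to hole -/

/-- The complements of `A` and of its image are both countably infinite, so any bijection between
them completes `f`. -/
theorem exists_perm_extending {A : Set ℕ} (hA : A.Finite) {f : ℕ → ℕ} (hf : Set.InjOn f A) :
    ∃ ρ : Equiv.Perm ℕ, ∀ t ∈ A, ρ t = f t := by
  classical
  have h1 : Infinite {t // ¬ t ∈ A} := hA.infinite_compl.to_subtype
  have h2 : Infinite {t // ¬ t ∈ f '' A} := (hA.image f).infinite_compl.to_subtype
  obtain ⟨e⟩ := nonempty_equiv_of_countable (α := {t // ¬ t ∈ A}) (β := {t // ¬ t ∈ f '' A})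
  refine ⟨Equiv.subtypeCongr (Equiv.Set.imageOfInjOn f A hf) e, fun t ht => ?_⟩
  simp [Equiv.subtypeCongr, Equiv.sumCompl_symm_apply_of_pos ht]
  rfl

/-- The next hole visited by the same token. -/
def IsNextVisit {T : Type} (τ : ℕ → T) (t t' : ℕ) : Prop :=
  t < t' ∧ τ t' = τ t ∧ ∀ k, t < k → k < t' → τ k ≠ τ t

/-- Routing of tokens through a sequence of holes. -/
theorem exists_routing (d : ℕ) :
    ∃ (Q : Type) (_ : Fintype Q) (_ : DecidableEq Q) (o : Q) (L : ℕ → List (Q × Q)),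
      ∑ t ∈ Finset.range (2 ^ d), (L t).length ≤ 3 * d * 2 ^ d ∧
      ∀ (T : Type) (τ : ℕ → T), ∃ S : ℕ → List (Q × Q), (∀ t, (S t).Sublist (L t)) ∧
        ∀ t t', IsNextVisit τ t t' → t' < 2 ^ d →
          FirstArrival (fun k => switchPerm (S k)) o t o t' := by
  classical
  obtain ⟨Q, i1, i2, o, L, hL, hρ⟩ := exists_network d
  refine ⟨Q, i1, i2, o, L, hL, fun T τ => ?_⟩
  let A : Set ℕ := {t | ∃ t', IsNextVisit τ t t' ∧ t' < 2 ^ d}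
  have hA : A.Finite := (Set.finite_lt_nat (2 ^ d)).subset fun t ⟨t', h, h'⟩ => h.1.trans h'
  have hex : ∀ t, ∃ t', t ∈ A → IsNextVisit τ t t' ∧ t' < 2 ^ d := fun t => by
    by_cases ht : t ∈ A
    · obtain ⟨t', h⟩ := ht
      exact ⟨t', fun _ => h⟩
    · exact ⟨0, fun h => absurd h ht⟩
  choose f hf using hex
  -- Two holes with the same next visit carry the same token, so the earlier one would meet the
  -- later one first.
  have hinj : Set.InjOn f A := by
    intro s hs t ht hst
    obtain ⟨⟨h1, h2, h3⟩, -⟩ := hf s hs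
    obtain ⟨⟨h4, h5, h6⟩, -⟩ := hf t ht
    rw [hst] at h1 h2 h3
    rcases lt_trichotomy s t with h | h | h
    · exact absurd (h5.symm.trans h2) (h3 t h h4)
    · exact h
    · exact absurd (h2.symm.trans h5) (h6 s h h1)
  obtain ⟨ρ, hρA⟩ := exists_perm_extending hA hinj
  obtain ⟨S, hS, hS'⟩ := hρ ρ
  refine ⟨S, hS, fun t t' h h' => ?_⟩
  have htA : t ∈ A := ⟨t', h, h'⟩
  have hft : f t = t' := by
    obtain ⟨⟨h1, h2, h3⟩, -⟩ := hf t htA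
    obtain ⟨h4, h5, h6⟩ := h
    rcases lt_trichotomy (f t) t' with h | h | h
    · exact absurd h2 (h6 _ h1 h)
    · exact h
    · exact absurd h5 (h3 _ h4 h)
  have h1 : ρ t = t' := (hρA t htA).trans hft
  have h2 := hS' t (by rw [h1]; exact h.1) (by rw [h1]; exact h')
  rwa [h1] at h2

/-! ### Simulation by subsequences of moves -/

/-- Some of the moves `L` take the states with the logical qubits at the places `π` to those with
the logical qubits at `π'`, and perform `F` on the logical qubits; all other qubits are `0`. -/
def Simulates {α β : Type} (L : List (Move α)) (π π' : β → α) (F : QState β → QState β) : Prop :=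
  ∃ L', L'.Sublist L ∧
    ∀ ψ, runMoves L' (pad π (fun _ => false) ψ) = pad π' (fun _ => false) (F ψ)

theorem Simulates.append {α β : Type} {L L' : List (Move α)} {π π' π'' : β → α}
    {F F' : QState β → QState β} (h : Simulates L π π' F) (h' : Simulates L' π' π'' F') :
    Simulates (L ++ L') π π'' (F' ∘ F) := by
  obtain ⟨M, hM, h1⟩ := h
  obtain ⟨M', hM', h2⟩ := h'
  refine ⟨M ++ M', hM.append hM', fun ψ => ?_⟩
  rw [runMoves_append, h1, h2, comp_apply]

theorem simulates_idle {α β : Type} (L : List (Move α)) (π : β → α) : Simulates L π π id :=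
  ⟨[], List.nil_sublist _, fun _ => rfl⟩

theorem permute_pad {α β : Type} (P : Equiv.Perm α) (π : β → α) (ψ : QState β) :
    permute P (pad π (fun _ => false) ψ) = pad (P ∘ π) (fun _ => false) ψ := by
  classical
  funext z
  have hc : (∀ i, i ∉ Set.range π → (z ∘ P) i = false) ↔
      ∀ i, i ∉ Set.range (P ∘ π) → z i = false := by
    constructor
    · intro h i hi
      have := h (P.symm i) (by
        rintro ⟨a, ha⟩
        exact hi ⟨a, by simp [ha]⟩)
      simpa using this
    · intro h i hi
      refine h _ ?_
      rintro ⟨a, ha⟩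
      exact hi ⟨a, P.injective ha⟩
  simp only [permute, pad, hc]
  rfl

theorem simulates_swap {α β : Type} [DecidableEq α] (i j : α) (π : β → α) :
    Simulates [.swap i j] π (Equiv.swap i j ∘ π) id := by
  refine ⟨_, List.Sublist.refl _, fun ψ => ?_⟩
  refine Eq.trans ?_ (permute_pad (Equiv.swap i j) π ψ)
  rw [runMoves, runMoves, Move.apply]
  congr!

theorem simulates_gate {α β : Type} {L : List (Move α)} {π : β → α} (hπ : Injective π)
    (p : WiredGate β) (hp : Move.gate (p.map ⟨π, hπ⟩) ∈ L) : Simulates L π π p.apply := by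
  refine ⟨[_], List.singleton_sublist.2 hp, fun ψ => ?_⟩
  exact act_pad (π := id) (b := fun _ => false)
    (F := fun φ => (p.gate.op : Op p.gate.width).mulVec φ) (fun ψ => by rw [pad_id, pad_id]; rfl)
    (Matrix.mulVec_zero _) (hπ.comp p.inj) hπ p.inj (fun a => rfl)
    (fun k hk => absurd ⟨k, rfl⟩ hk) (fun k hk => absurd ⟨k, rfl⟩ hk) ψ

/-- The register of the universal circuit: the data qubits, the wires of the network, and a
buffer. -/
abbrev Work (n : ℕ) (Q : Type) : Type := Fin n ⊕ Option Q

/-- A position of the network. -/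
abbrev wire {n : ℕ} {Q : Type} (q : Q) : Work n Q := Sum.inr (some q)

/-- The buffer. -/
abbrev buffer {n : ℕ} {Q : Type} : Work n Q := Sum.inr none

/-- Moving the wires of the network. -/
def relocate {n : ℕ} {Q : Type} (P : Equiv.Perm Q) : Work n Q → Work n Q :=
  Sum.map id (Option.map P)

theorem relocate_injective {n : ℕ} {Q : Type} (P : Equiv.Perm Q) :
    Injective (relocate P : Work n Q → Work n Q) :=
  Sum.map_injective.2 ⟨injective_id, Option.map_injective P.injective⟩

/-- A sequence of switches as a sequence of moves. -/
def layerMoves {n : ℕ} {Q : Type} (L : List (Q × Q)) : List (Move (Work n Q)) :=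
  L.map fun s => .swap (wire s.1) (wire s.2)

theorem simulates_layer {n : ℕ} {Q β : Type} [DecidableEq Q] {S L : List (Q × Q)}
    (h : S.Sublist L) (π : β → Work n Q) :
    Simulates (layerMoves L) π (relocate (switchPerm S) ∘ π) id := by
  classical
  refine ⟨layerMoves S, h.map _, fun ψ => ?_⟩
  clear h
  induction S generalizing π with
  | nil =>
    have h : (relocate (switchPerm []) : Work n Q → Work n Q) = id := by
      funext x
      rcases x with i | _ | q <;> rfl
    rw [h]
    rfl
  | cons s S ih =>
    have h : (relocate (switchPerm (s :: S)) : Work n Q → Work n Q) =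
        relocate (switchPerm S) ∘ Equiv.swap (wire s.1) (wire s.2) := by
      funext x
      rcases x with i | _ | q
      · rw [comp_apply, Equiv.swap_apply_of_ne_of_ne (by simp) (by simp)]
        rfl
      · rw [comp_apply, Equiv.swap_apply_of_ne_of_ne (by simp) (by simp)]
        rfl
      · have h1 : Equiv.swap (wire s.1) (wire s.2) (wire q : Work n Q) =
            wire (Equiv.swap s.1 s.2 q) := by
          simp only [Equiv.swap_apply_def, Sum.inr.injEq, Option.some.injEq]
          split_ifs <;> rfl
        change _ = relocate (switchPerm S) (Equiv.swap (wire s.1) (wire s.2) (wire q))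
        rw [h1]
        rfl
    rw [h, comp_assoc, ← ih]
    change runMoves (layerMoves S) (permute _ _) = _
    rw [permute_pad]
    congr!

/-! ### Tokens on the wires -/

/-- The settings `σ` of a network with `N` holes take each token from hole to hole. -/
def Routed {n : ℕ} {Q : Type} (N : ℕ) (σ : ℕ → Equiv.Perm Q) (o : Q) (τ : ℕ → Fin n) : Prop :=
  ∀ t t', IsNextVisit τ t t' → t' < N → FirstArrival σ o t o t'

/-- After the hole `s`, the place `x` of the token `a` is on a wire that will carry it to the next
hole that it visits. -/
def OnWire {n : ℕ} {Q : Type} (N : ℕ) (σ : ℕ → Equiv.Perm Q) (o : Q) (τ : ℕ → Fin n) (s : ℕ)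
    (a : Fin n) (x : Work n Q) : Prop :=
  ∃ q, x = wire q ∧ ∀ t', s < t' → t' < N → τ t' = a → (∀ k, s < k → k < t' → τ k ≠ a) →
    FirstArrival σ o s q t'

section Routing

variable {n : ℕ} {Q : Type} {N : ℕ} {σ : ℕ → Equiv.Perm Q} {o : Q} {τ : ℕ → Fin n}

theorem Routed.onWire (h : Routed N σ o τ) {s : ℕ} {a : Fin n} (ha : τ s = a) :
    OnWire N σ o τ s a (wire o) := by
  subst ha
  exact ⟨o, rfl, fun t' h1 h2 h3 h4 => h s t' ⟨h1, h3, h4⟩ h2⟩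

theorem OnWire.arrives {s : ℕ} {a : Fin n} {x : Work n Q} (h : OnWire N σ o τ s a x)
    (hs : s + 1 < N) (ha : τ (s + 1) = a) : relocate (σ (s + 1)) x = wire o := by
  obtain ⟨q, rfl, hq⟩ := h
  have h1 := (hq (s + 1) (by omega) hs ha (fun k h1 h2 => by omega)).eq_of_succ
  change wire (σ (s + 1) q) = wire o
  rw [h1]

theorem OnWire.step {s : ℕ} {a : Fin n} {x : Work n Q} (h : OnWire N σ o τ s a x)
    (ha : τ (s + 1) ≠ a) : OnWire N σ o τ (s + 1) a (relocate (σ (s + 1)) x) := by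
  obtain ⟨q, rfl, hq⟩ := h
  refine ⟨σ (s + 1) q, rfl, fun t' h1 h2 h3 h4 => ?_⟩
  refine ((hq t' (by omega) h2 h3 fun k h5 h6 => ?_).tail (by omega)).2
  rcases Nat.eq_or_lt_of_le (Nat.succ_le_of_lt h5) with h7 | h7
  · rw [← h7]
    exact ha
  · exact h4 k h7 h6

/-- `FirstArrival` keeps a wire away from `o` only until its target hole, so a later visit has to
exist. The unloading holes provide one. -/
theorem OnWire.passes {s : ℕ} {a : Fin n} {x : Work n Q} (h : OnWire N σ o τ s a x)
    (ha : τ (s + 1) ≠ a) (hex : ∃ t', s < t' ∧ t' < N ∧ τ t' = a) :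
    relocate (σ (s + 1)) x ≠ wire o := by
  classical
  obtain ⟨q, rfl, hq⟩ := h
  obtain ⟨h1, h2, h3⟩ := Nat.find_spec hex
  have h4 := hq _ h1 h2 h3 fun k h5 h6 h7 => Nat.find_min hex h6 ⟨h5, h6.trans h2, h7⟩
  have h5 := (h4.tail (fun h => ha (by rw [← h]; exact h3))).1
  intro h6
  exact h5 (Option.some_injective _ (Sum.inr_injective h6))

theorem OnWire.ne_inl {s : ℕ} {a i : Fin n} {x : Work n Q} (h : OnWire N σ o τ s a x) :
    x ≠ Sum.inl i := by
  obtain ⟨q, rfl, -⟩ := h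
  simp

theorem OnWire.ne_buffer {s : ℕ} {a : Fin n} {x : Work n Q} (h : OnWire N σ o τ s a x) :
    x ≠ buffer := by
  obtain ⟨q, rfl, -⟩ := h
  simp

end Routing

theorem gateWires_injective {n w : ℕ} {Q : Type} (hw : w ≤ 2) (o : Q) :
    Injective (fun i : Fin w => if i.val = 0 then (buffer : Work n Q) else wire o) := by
  intro i j h
  have hi := i.isLt
  have hj := j.isLt
  simp only at h
  split_ifs at h
  · exact Fin.ext (by omega)
  · simp at h
  · simp at h
  · exact Fin.ext (by omega)

/-! ### The universal sequence of moves -/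

/-- The gates of a list, applied to the buffer and the hole. -/
def gateMoves {n : ℕ} {Q : Type} (Γ : List {g : Gate // g.width ≤ 2}) (o : Q) :
    List (Move (Work n Q)) :=
  Γ.map fun g => .gate ⟨g.1, _, gateWires_injective g.2 o⟩

/-- The moves at the hole `s + 1`: the first `n` holes bring the data into the network, each of the
next `c` triples of holes applies a gate, the last `n` holes take the data out. -/
def holeMoves {n : ℕ} [NeZero n] {Q : Type} (Γ : List {g : Gate // g.width ≤ 2}) (o : Q)
    (c s : ℕ) : List (Move (Work n Q)) :=
  if s < n then [.swap (Sum.inl (Fin.ofNat n s)) (wire o)]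
  else if s < n + 3 * c then
    if (s - n) % 3 = 1 then gateMoves Γ o else [.swap buffer (wire o)]
  else [.swap (Sum.inl (Fin.ofNat n (s - (n + 3 * c)))) (wire o)]

/-- All moves of the universal circuit up to the hole `s`. -/
def skeleton {n : ℕ} [NeZero n] {Q : Type} (L : ℕ → List (Q × Q))
    (Γ : List {g : Gate // g.width ≤ 2}) (o : Q) (c : ℕ) : ℕ → List (Move (Work n Q))
  | 0 => []
  | s + 1 => skeleton L Γ o c s ++ (layerMoves (L (s + 1)) ++ holeMoves Γ o c s)

/-- The token that visits the hole `t`, where the `k`-th gate acts on the tokens `slot k`. -/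
def visitor {n : ℕ} [NeZero n] (slot : ℕ → Fin n × Fin n) (c t : ℕ) : Fin n :=
  -- The holes in use are numbered from `1`. The value at `0` is irrelevant, as no token is on a
  -- wire at that time.
  if t - 1 < n then Fin.ofNat n (t - 1)
  else if t - 1 < n + 3 * c then
    if (t - 1 - n) % 3 = 1 then (slot ((t - 1 - n) / 3)).2 else (slot ((t - 1 - n) / 3)).1
  else Fin.ofNat n (t - 1 - (n + 3 * c))

section Simulation

variable {n : ℕ} [NeZero n] {Q : Type} [DecidableEq Q] {L S : ℕ → List (Q × Q)}
  {Γ : List {g : Gate // g.width ≤ 2}} {o : Q} {c N : ℕ} {slot : ℕ → Fin n × Fin n}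

theorem simulates_skeleton_succ (hS : ∀ t, (S t).Sublist (L t)) {s : ℕ}
    {π₀ π π' : Fin n → Work n Q} {F F' F'' : State n → State n}
    (h : Simulates (skeleton L Γ o c s) π₀ π F)
    (h' : Simulates (holeMoves Γ o c s) (relocate (switchPerm (S (s + 1))) ∘ π) π' F')
    (hF : F' ∘ F = F'') : Simulates (skeleton L Γ o c (s + 1)) π₀ π' F'' :=
  hF ▸ h.append ((simulates_layer (hS (s + 1)) π).append h')

theorem exists_later_visit (hN : 2 * n + 3 * c < N) {s : ℕ} (a : Fin n)
    (hs : s ≤ n + 3 * c + a) : ∃ t', s < t' ∧ t' < N ∧ visitor slot c t' = a := by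
  have ha := a.isLt
  refine ⟨n + 3 * c + a + 1, by omega, by omega, ?_⟩
  unfold visitor
  rw [if_neg (by omega), if_neg (by omega)]
  apply Fin.ext
  rw [Fin.val_ofNat, show n + 3 * c + a + 1 - 1 - (n + 3 * c) = (a : ℕ) by omega,
    Nat.mod_eq_of_lt ha]

theorem exists_placement_loaded (hS : ∀ t, (S t).Sublist (L t)) (hN : 2 * n + 3 * c < N)
    (hR : Routed N (fun k => switchPerm (S k)) o (visitor slot c)) (s : ℕ) (hs : s ≤ n) :
    ∃ π : Fin n → Work n Q, Injective π ∧ Simulates (skeleton L Γ o c s) Sum.inl π id ∧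
      ∀ a : Fin n, (a.val < s → OnWire N (fun k => switchPerm (S k)) o (visitor slot c) s a (π a)) ∧
        (s ≤ a.val → π a = Sum.inl a) := by
  induction s with
  | zero =>
    exact ⟨Sum.inl, Sum.inl_injective, simulates_idle _ _, fun a =>
      ⟨fun h => absurd h (Nat.not_lt_zero _), fun _ => rfl⟩⟩
  | succ s ih =>
    obtain ⟨π, hπ, hsim, hloc⟩ := ih (by omega)
    have ht : visitor slot c (s + 1) = ⟨s, hs⟩ := by
      unfold visitor
      rw [Nat.add_sub_cancel, if_pos (by omega)]
      exact Fin.ext (Nat.mod_eq_of_lt hs)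
    have hm : (holeMoves Γ o c s : List (Move (Work n Q))) =
        [.swap (Sum.inl ⟨s, hs⟩) (wire o)] := by
      unfold holeMoves
      rw [if_pos (by omega)]
      congr 3
      exact Fin.ext (Nat.mod_eq_of_lt hs)
    have h1 := simulates_swap (Sum.inl ⟨s, hs⟩) (wire o)
      (relocate (switchPerm (S (s + 1))) ∘ π)
    rw [← hm] at h1
    refine ⟨_, (Equiv.injective _).comp ((relocate_injective _).comp hπ),
      simulates_skeleton_succ hS hsim h1 rfl, fun a => ⟨fun ha => ?_, fun ha => ?_⟩⟩
    · rcases Nat.eq_or_lt_of_le (Nat.lt_succ_iff.1 ha) with h | h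
      · have ha' : a = ⟨s, hs⟩ := Fin.ext h
        have h2 := (hloc a).2 (by omega)
        rw [comp_apply, comp_apply, h2, ha']
        change OnWire _ _ _ _ _ _ (Equiv.swap _ _ (Sum.inl ⟨s, hs⟩))
        rw [Equiv.swap_apply_left]
        exact hR.onWire ht
      · have h2 := (hloc a).1 h
        have h3 : visitor slot c (s + 1) ≠ a := by
          rw [ht]
          rintro rfl
          exact absurd h (lt_irrefl _)
        have h4 := h2.step h3
        have h5 := h2.passes h3 (exists_later_visit hN a (by omega))
        rw [comp_apply, comp_apply, Equiv.swap_apply_of_ne_of_ne h4.ne_inl h5]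
        exact h4
    · have h2 := (hloc a).2 (by omega)
      rw [comp_apply, comp_apply, h2]
      change Equiv.swap _ _ (Sum.inl a) = _
      refine Equiv.swap_apply_of_ne_of_ne (fun h => ?_) (by simp)
      have := congrArg Fin.val (Sum.inl_injective h)
      simp only at this
      omega

theorem exists_placement_idle (hS : ∀ t, (S t).Sublist (L t)) (hN : 2 * n + 3 * c < N)
    (hR : Routed N (fun k => switchPerm (S k)) o (visitor slot c)) {s : ℕ} (hs : s < n + 3 * c)
    {π₀ π : Fin n → Work n Q} {F : State n → State n} (hπ : Injective π)
    (hsim : Simulates (skeleton L Γ o c s) π₀ π F)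
    (hloc : ∀ a, OnWire N (fun k => switchPerm (S k)) o (visitor slot c) s a (π a)) :
    ∃ π' : Fin n → Work n Q, Injective π' ∧ Simulates (skeleton L Γ o c (s + 1)) π₀ π' F ∧
      ∀ a, OnWire N (fun k => switchPerm (S k)) o (visitor slot c) (s + 1) a (π' a) := by
  refine ⟨_, (relocate_injective _).comp hπ,
    simulates_skeleton_succ hS hsim (simulates_idle _ _) rfl, fun a => ?_⟩
  by_cases ha : visitor slot c (s + 1) = a
  · rw [comp_apply, (hloc a).arrives (by omega) ha]
    exact hR.onWire ha
  · exact (hloc a).step ha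

/-- The network brings one token at a time to `o`, whence the buffer. For a single-qubit gate both
slots name the same token, and the gate acts on the buffer alone. -/
theorem exists_placement_gate (hS : ∀ t, (S t).Sublist (L t)) (hN : 2 * n + 3 * c < N)
    (hR : Routed N (fun k => switchPerm (S k)) o (visitor slot c)) {k : ℕ} (hk : k < c)
    {π₀ π : Fin n → Work n Q} {F : State n → State n} (hπ : Injective π)
    (hsim : Simulates (skeleton L Γ o c (n + 3 * k)) π₀ π F)
    (hloc : ∀ a, OnWire N (fun k => switchPerm (S k)) o (visitor slot c) (n + 3 * k) a (π a))
    (p : WiredGate (Fin n)) (hw : p.gate.width ≤ 2) (hp : ⟨p.gate, hw⟩ ∈ Γ)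
    (hfst : ∀ i, i.val = 0 → p.wires i = (slot k).1)
    (hsnd : ∀ i, i.val = 1 → p.wires i = (slot k).2) :
    ∃ π' : Fin n → Work n Q, Injective π' ∧
      Simulates (skeleton L Γ o c (n + 3 * (k + 1))) π₀ π' (p.apply ∘ F) ∧
      ∀ a, OnWire N (fun k => switchPerm (S k)) o (visitor slot c) (n + 3 * (k + 1)) a (π' a) := by
  set s := n + 3 * k with hs
  have ht1 : visitor slot c (s + 1) = (slot k).1 := by
    unfold visitor
    rw [if_neg (by omega), if_pos (by omega), if_neg (by omega)]
    congr 2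
    omega
  have ht2 : visitor slot c (s + 1 + 1) = (slot k).2 := by
    unfold visitor
    rw [if_neg (by omega), if_pos (by omega), if_pos (by omega)]
    congr 2
    omega
  have ht3 : visitor slot c (s + 1 + 1 + 1) = (slot k).1 := by
    unfold visitor
    rw [if_neg (by omega), if_pos (by omega), if_neg (by omega)]
    congr 2
    omega
  have hm1 : (holeMoves Γ o c s : List (Move (Work n Q))) = [.swap buffer (wire o)] := by
    unfold holeMoves
    rw [if_neg (by omega), if_pos (by omega), if_neg (by omega)]
  have hm2 : (holeMoves Γ o c (s + 1) : List (Move (Work n Q))) = gateMoves Γ o := by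
    unfold holeMoves
    rw [if_neg (by omega), if_pos (by omega), if_pos (by omega)]
  have hm3 : (holeMoves Γ o c (s + 1 + 1) : List (Move (Work n Q))) =
      [.swap buffer (wire o)] := by
    unfold holeMoves
    rw [if_neg (by omega), if_pos (by omega), if_neg (by omega)]
  have hlater : ∀ (a : Fin n) (t : ℕ), t < n + 3 * c →
      ∃ t', t < t' ∧ t' < N ∧ visitor slot c t' = a :=
    fun a t h => exists_later_visit hN a (by omega)
  -- the first token goes to the buffer
  obtain ⟨π₁, hπ₁, hsim₁, hbuf₁, hloc₁⟩ : ∃ π₁ : Fin n → Work n Q, Injective π₁ ∧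
      Simulates (skeleton L Γ o c (s + 1)) π₀ π₁ F ∧ π₁ (slot k).1 = buffer ∧
      ∀ a, a ≠ (slot k).1 →
        OnWire N (fun k => switchPerm (S k)) o (visitor slot c) (s + 1) a (π₁ a) := by
    have h1 := simulates_swap buffer (wire o) (relocate (switchPerm (S (s + 1))) ∘ π)
    rw [← hm1] at h1
    refine ⟨_, (Equiv.injective _).comp ((relocate_injective _).comp hπ),
      simulates_skeleton_succ hS hsim h1 rfl, ?_, fun a ha => ?_⟩
    · rw [comp_apply, comp_apply, (hloc _).arrives (by omega) ht1, Equiv.swap_apply_right]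
    · have h3 : visitor slot c (s + 1) ≠ a := by
        rw [ht1]
        exact ha.symm
      have h4 := (hloc a).step h3
      have h5 := (hloc a).passes h3 (hlater a _ (by omega))
      rw [comp_apply, comp_apply, Equiv.swap_apply_of_ne_of_ne h4.ne_buffer h5]
      exact h4
  -- the gate is applied to the buffer and the second token
  obtain ⟨π₂, hπ₂, hsim₂, hbuf₂, hloc₂⟩ : ∃ π₂ : Fin n → Work n Q, Injective π₂ ∧
      Simulates (skeleton L Γ o c (s + 1 + 1)) π₀ π₂ (p.apply ∘ F) ∧ π₂ (slot k).1 = buffer ∧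
      ∀ a, a ≠ (slot k).1 →
        OnWire N (fun k => switchPerm (S k)) o (visitor slot c) (s + 1 + 1) a (π₂ a) := by
    have hinj := (relocate_injective (n := n) (switchPerm (S (s + 1 + 1)))).comp hπ₁
    have hb : (relocate (switchPerm (S (s + 1 + 1))) ∘ π₁) (slot k).1 = buffer := by
      rw [comp_apply, hbuf₁]
      rfl
    refine ⟨_, hinj, simulates_skeleton_succ hS hsim₁ (simulates_gate hinj p ?_) rfl, hb,
      fun a ha => ?_⟩
    · rw [hm2, gateMoves, List.mem_map]
      refine ⟨_, hp, ?_⟩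
      have hwires : (fun i : Fin p.gate.width => if i.val = 0 then (buffer : Work n Q)
          else wire o) = (relocate (switchPerm (S (s + 1 + 1))) ∘ π₁) ∘ p.wires := by
        funext i
        have hi := i.isLt
        by_cases h0 : i.val = 0
        · rw [if_pos h0, comp_apply, hfst i h0, hb]
        · have h1 : i.val = 1 := by omega
          have hne : (slot k).2 ≠ (slot k).1 := by
            rw [← hsnd i h1, ← hfst ⟨0, by omega⟩ rfl]
            intro h
            have := congrArg Fin.val (p.inj h)
            simp only at this
            omega
          rw [if_neg h0, comp_apply, hsnd i h1, comp_apply,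
            (hloc₁ _ hne).arrives (by omega) ht2]
      unfold WiredGate.map
      congr
    · by_cases h3 : visitor slot c (s + 1 + 1) = a
      · rw [comp_apply, (hloc₁ a ha).arrives (by omega) h3]
        exact hR.onWire h3
      · exact (hloc₁ a ha).step h3
  -- the first token comes back from the buffer
  have h1 := simulates_swap buffer (wire o) (relocate (switchPerm (S (s + 1 + 1 + 1))) ∘ π₂)
  rw [← hm3] at h1
  have hs3 : n + 3 * (k + 1) = s + 1 + 1 + 1 := by omega
  rw [hs3]
  refine ⟨_, (Equiv.injective _).comp ((relocate_injective _).comp hπ₂),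
    simulates_skeleton_succ hS hsim₂ h1 rfl, fun a => ?_⟩
  by_cases ha : a = (slot k).1
  · have hb : relocate (switchPerm (S (s + 1 + 1 + 1))) (π₂ a) = buffer := by
      rw [ha, hbuf₂]
      rfl
    rw [comp_apply, comp_apply, hb, Equiv.swap_apply_left]
    exact hR.onWire (by rw [ht3, ha])
  · have h3 : visitor slot c (s + 1 + 1 + 1) ≠ a := by
      rw [ht3]
      exact fun h => ha h.symm
    have h4 := (hloc₂ a ha).step h3
    have h5 := (hloc₂ a ha).passes h3 (hlater a _ (by omega))
    rw [comp_apply, comp_apply, Equiv.swap_apply_of_ne_of_ne h4.ne_buffer h5]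
    exact h4

/-- Injectivity of the placement is no longer tracked, as no gate is applied after this point. -/
theorem exists_placement_unloaded (hS : ∀ t, (S t).Sublist (L t)) (hN : 2 * n + 3 * c < N)
    {π₀ π : Fin n → Work n Q} {F : State n → State n}
    (hsim : Simulates (skeleton L Γ o c (n + 3 * c)) π₀ π F)
    (hloc : ∀ a, OnWire N (fun k => switchPerm (S k)) o (visitor slot c) (n + 3 * c) a (π a))
    (j : ℕ) (hj : j ≤ n) :
    ∃ π' : Fin n → Work n Q, Simulates (skeleton L Γ o c (n + 3 * c + j)) π₀ π' F ∧
      ∀ a : Fin n, (a.val < j → π' a = Sum.inl a) ∧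
        (j ≤ a.val → OnWire N (fun k => switchPerm (S k)) o (visitor slot c)
          (n + 3 * c + j) a (π' a)) := by
  induction j with
  | zero => exact ⟨π, hsim, fun a => ⟨fun h => absurd h (Nat.not_lt_zero _), fun _ => hloc a⟩⟩
  | succ j ih =>
    obtain ⟨π', hsim', hloc'⟩ := ih (by omega)
    set s := n + 3 * c + j with hs
    have ht : visitor slot c (s + 1) = ⟨j, hj⟩ := by
      unfold visitor
      rw [if_neg (by omega), if_neg (by omega)]
      apply Fin.ext
      rw [Fin.val_ofNat, show s + 1 - 1 - (n + 3 * c) = j by omega, Nat.mod_eq_of_lt hj]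
    have hm : (holeMoves Γ o c s : List (Move (Work n Q))) =
        [.swap (Sum.inl ⟨j, hj⟩) (wire o)] := by
      unfold holeMoves
      rw [if_neg (by omega), if_neg (by omega)]
      congr 3
      apply Fin.ext
      rw [Fin.val_ofNat, show s - (n + 3 * c) = j by omega, Nat.mod_eq_of_lt hj]
    have h1 := simulates_swap (Sum.inl ⟨j, hj⟩) (wire o)
      (relocate (switchPerm (S (s + 1))) ∘ π')
    rw [← hm] at h1
    refine ⟨_, simulates_skeleton_succ hS hsim' h1 rfl, fun a => ⟨fun ha => ?_, fun ha => ?_⟩⟩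
    · rcases Nat.eq_or_lt_of_le (Nat.lt_succ_iff.1 ha) with h | h
      · have ha' : a = ⟨j, hj⟩ := Fin.ext h
        have h2 := (hloc' a).2 (by omega)
        rw [comp_apply, comp_apply, h2.arrives (by omega) (by rw [ht, ha']),
          Equiv.swap_apply_right, ha']
      · rw [comp_apply, comp_apply, (hloc' a).1 h]
        change Equiv.swap _ _ (Sum.inl a) = _
        refine Equiv.swap_apply_of_ne_of_ne (fun h' => ?_) (by simp)
        have := congrArg Fin.val (Sum.inl_injective h')
        simp only at this
        omega
    · have h2 := (hloc' a).2 (by omega)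
      have h3 : visitor slot c (s + 1) ≠ a := by
        rw [ht]
        rintro rfl
        simp only at ha
        omega
      have h4 := h2.step h3
      have h5 := h2.passes h3 (exists_later_visit hN a (by omega))
      rw [comp_apply, comp_apply, Equiv.swap_apply_of_ne_of_ne h4.ne_inl h5]
      exact h4

end Simulation

/-! ### Assembly and size -/

theorem exists_gate_list {G : Set Gate} (hfin : G.Finite)
    (hwidth : ∀ g ∈ G, g.width = 1 ∨ g.width = 2) :
    ∃ Γ : List {g : Gate // g.width ≤ 2}, (∀ g ∈ Γ, g.1 ∈ G) ∧
      ∀ g ∈ G, ∃ h : g.width ≤ 2, ⟨g, h⟩ ∈ Γ := by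
  have h1 : (Subtype.val ⁻¹' G : Set {g : Gate // g.width ≤ 2}).Finite :=
    hfin.preimage Subtype.val_injective.injOn
  refine ⟨h1.toFinset.toList, fun g hg => by simpa using hg, fun g hg => ?_⟩
  have h2 : g.width ≤ 2 := by
    have := hwidth g hg
    omega
  exact ⟨h2, by simpa using hg⟩

/-- The skeleton performs each circuit with at most `c` gates from the list `Γ`. -/
theorem simulates_circuit {n : ℕ} [NeZero n] {Q : Type} [DecidableEq Q] {L : ℕ → List (Q × Q)}
    {Γ : List {g : Gate // g.width ≤ 2}} {o : Q} {c N : ℕ} (hN : 2 * n + 3 * c < N)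
    (hL : ∀ τ : ℕ → Fin n, ∃ S : ℕ → List (Q × Q), (∀ t, (S t).Sublist (L t)) ∧
      Routed N (fun k => switchPerm (S k)) o τ)
    (C : List (WiredGate (Fin n))) (hC : C.length ≤ c)
    (hΓ : ∀ p ∈ C, p.gate.width ≠ 0 ∧ ∃ h, ⟨p.gate, h⟩ ∈ Γ) :
    Simulates (skeleton L Γ o c (2 * n + 3 * c)) (Sum.inl : Fin n → Work n Q) Sum.inl (run C) := by
  have hslot : ∀ k, ∃ s : Fin n × Fin n, ∀ h : k < C.length,
      (∀ i : Fin C[k].gate.width, i.val = 0 → C[k].wires i = s.1) ∧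
      ∀ i : Fin C[k].gate.width, i.val = 1 → C[k].wires i = s.2 := fun k => by
    by_cases h : k < C.length
    · obtain ⟨h0, h2, -⟩ := hΓ C[k] (List.getElem_mem h)
      -- The index `width - 1` is the second wire of a two-qubit gate and repeats the only wire of a
      -- single-qubit gate.
      refine ⟨(C[k].wires ⟨0, by omega⟩, C[k].wires ⟨C[k].gate.width - 1, by omega⟩), fun _ =>
        ⟨fun i hi => ?_, fun i hi => ?_⟩⟩
      · exact congrArg _ (Fin.ext hi)
      · have := i.isLt
        exact congrArg _ (Fin.ext (by simp only; omega))
    · exact ⟨(0, 0), fun h' => absurd h' h⟩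
  choose slot hslot using hslot
  obtain ⟨S, hS, hR⟩ := hL (visitor slot c)
  obtain ⟨π, hπ, hsim, hloc⟩ := exists_placement_loaded (Γ := Γ) hS hN hR n le_rfl
  have hgates : ∀ k ≤ c, ∃ π : Fin n → Work n Q, Injective π ∧
      Simulates (skeleton L Γ o c (n + 3 * k)) Sum.inl π (run (C.take k)) ∧
      ∀ a, OnWire N (fun k => switchPerm (S k)) o (visitor slot c) (n + 3 * k) a (π a) := by
    intro k hk
    induction k with
    | zero => exact ⟨π, hπ, hsim, fun a => (hloc a).1 a.isLt⟩
    | succ k ih =>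
      obtain ⟨π, hπ, hsim, hloc⟩ := ih (by omega)
      by_cases hkC : k < C.length
      · obtain ⟨-, h2, hΓk⟩ := hΓ C[k] (List.getElem_mem hkC)
        obtain ⟨h3, h4⟩ := hslot k hkC
        obtain ⟨π', hπ', hsim', hloc'⟩ := exists_placement_gate hS hN hR (by omega) hπ hsim hloc
          C[k] h2 hΓk h3 h4
        refine ⟨π', hπ', ?_, hloc'⟩
        have h5 : run (C.take (k + 1)) = C[k].apply ∘ run (C.take k) := by
          funext ψ
          rw [List.take_succ_eq_append_getElem hkC, run_append]
          rfl
        rwa [h5]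
      -- A circuit with fewer than `c` gates leaves the remaining triples of holes unused; the
      -- tokens just pass through them.
      · obtain ⟨π₁, hπ₁, hsim₁, hloc₁⟩ := exists_placement_idle hS hN hR (by omega) hπ hsim hloc
        obtain ⟨π₂, hπ₂, hsim₂, hloc₂⟩ :=
          exists_placement_idle hS hN hR (by omega) hπ₁ hsim₁ hloc₁
        obtain ⟨π₃, hπ₃, hsim₃, hloc₃⟩ :=
          exists_placement_idle hS hN hR (by omega) hπ₂ hsim₂ hloc₂
        refine ⟨π₃, hπ₃, ?_, hloc₃⟩
        rw [List.take_of_length_le (by omega)] at hsim₃ ⊢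
        exact hsim₃
  obtain ⟨π, hπ, hsim, hloc⟩ := hgates c le_rfl
  obtain ⟨π', hsim', hloc'⟩ := exists_placement_unloaded hS hN hsim hloc n le_rfl
  have h1 : π' = Sum.inl := funext fun a => (hloc' a).1 a.isLt
  rw [h1, List.take_of_length_le hC] at hsim'
  have h2 : 2 * n + 3 * c = n + 3 * c + n := by omega
  rwa [h2]

theorem length_holeMoves_le {n : ℕ} [NeZero n] {Q : Type} (Γ : List {g : Gate // g.width ≤ 2})
    (o : Q) (c s : ℕ) : (holeMoves Γ o c s : List (Move (Work n Q))).length ≤ Γ.length + 1 := by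
  unfold holeMoves gateMoves
  split_ifs <;> simp

theorem length_skeleton_le {n : ℕ} [NeZero n] {Q : Type} (L : ℕ → List (Q × Q))
    (Γ : List {g : Gate // g.width ≤ 2}) (o : Q) (c s : ℕ) :
    (skeleton L Γ o c s : List (Move (Work n Q))).length ≤
      ∑ t ∈ Finset.range (s + 1), (L t).length + s * (Γ.length + 1) := by
  induction s with
  | zero => simp [skeleton]
  | succ s ih =>
    have := length_holeMoves_le (n := n) Γ o c s
    rw [skeleton, Finset.sum_range_succ, List.length_append, List.length_append, layerMoves,
      List.length_map, Nat.succ_mul]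
    omega

theorem isOver_skeleton {n : ℕ} [NeZero n] {Q : Type} {G : Set Gate} (L : ℕ → List (Q × Q))
    {Γ : List {g : Gate // g.width ≤ 2}} (hΓ : ∀ g ∈ Γ, g.1 ∈ G) (o : Q) (c s : ℕ) :
    ∀ M ∈ (skeleton L Γ o c s : List (Move (Work n Q))), M.IsOver G := by
  induction s with
  | zero => simp [skeleton]
  | succ s ih =>
    intro M hM
    rw [skeleton, List.mem_append, List.mem_append] at hM
    rcases hM with hM | hM | hM
    · exact ih M hM
    · obtain ⟨p, -, rfl⟩ := List.mem_map.1 hM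
      trivial
    · unfold holeMoves at hM
      split_ifs at hM
      · rw [List.mem_singleton.1 hM]
        trivial
      · obtain ⟨g, hg, rfl⟩ := List.mem_map.1 hM
        exact hΓ g hg
      · rw [List.mem_singleton.1 hM]
        trivial
      · rw [List.mem_singleton.1 hM]
        trivial

theorem exists_universal_circuit {G : Set Gate} {K : ℕ}
    (hK : ∀ (α : Type) [Fintype α] (M : Move α), M.IsOver G → Programmable G {id, M.apply} K)
    (hwidth : ∀ g ∈ G, g.width = 1 ∨ g.width = 2)
    {Γ : List {g : Gate // g.width ≤ 2}} (hΓ : ∀ g ∈ Γ, g.1 ∈ G)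
    (hΓ' : ∀ g ∈ G, ∃ h : g.width ≤ 2, ⟨g, h⟩ ∈ Γ) {n c d : ℕ} (hn : 0 < n)
    (hd : 2 * n + 3 * c < 2 ^ d) :
    ∃ (m : ℕ) (U : Circuit (n + m)), U.IsOver G ∧ U.IsUniversalFor (circuitsOfSize G n c) ∧
      U.size ≤ K * (3 * d * 2 ^ d + 2 ^ d * (Γ.length + 1)) := by
  have : NeZero n := ⟨hn.ne'⟩
  obtain ⟨Q, i1, i2, o, L, hL, hroute⟩ := exists_routing d
  have h1 := programmable_sublists (hK (Work n Q)) (skeleton L Γ o c (2 * n + 3 * c))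
    (isOver_skeleton L hΓ o c _)
  have h2 : Programmable G {F : State n → State n | ∃ C ∈ circuitsOfSize G n c,
      F = fun ψ => (Circuit.toOp C).mulVec ψ}
      (K * (skeleton L Γ o c (2 * n + 3 * c) : List (Move (Work n Q))).length) := by
    -- The wires and the buffer start and end in the zero state, since every token is back at its
    -- data qubit, so they count as ancillas.
    refine h1.fix Embedding.inl ?_
    rintro _ ⟨C, ⟨hC, hc⟩, rfl⟩
    obtain ⟨L', hL', h⟩ := simulates_circuit (Γ := Γ) (o := o) hd (fun τ => hroute _ τ)
      (C.map PlacedGate.wired) (by simpa [Circuit.size] using hc) (by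
        intro p hp
        obtain ⟨q, hq, rfl⟩ := List.mem_map.1 hp
        have := hwidth _ (hC q hq)
        refine ⟨?_, hΓ' _ (hC q hq)⟩
        change q.gate.width ≠ 0
        omega)
    refine ⟨_, ⟨L', hL', rfl⟩, fun _ => false, fun ψ => ?_⟩
    refine (h ψ).trans ?_
    rw [← Circuit.toOp_mulVec]
    rfl
  obtain ⟨m, U, hU, hs, hx⟩ := h2.exists_circuit
  refine ⟨m, U, hU, fun C hC => hx _ ⟨C, hC, rfl⟩, hs.trans (Nat.mul_le_mul_left _ ?_)⟩
  refine (length_skeleton_le L Γ o c _).trans (Nat.add_le_add ?_ (Nat.mul_le_mul_right _ hd.le))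
  refine (Finset.sum_le_sum_of_subset ?_).trans hL
  intro t ht
  rw [Finset.mem_range] at ht ⊢
  omega

theorem cost_le_mul_log {K γ N d : ℕ} (hN : 2 ≤ N) (hd : 2 ^ d ≤ 8 * N) :
    ((K * (3 * d * 2 ^ d + 2 ^ d * (γ + 1)) : ℕ) : ℝ) ≤
      (K * (192 + 16 * (γ + 1)) : ℝ) * N * Real.log N := by
  have hN' : (2 : ℝ) ≤ N := by exact_mod_cast hN
  have hlog2 := Real.log_two_gt_d9
  have hlog2' := Real.log_two_lt_d9
  have hlogN : Real.log 2 ≤ Real.log N := Real.log_le_log (by norm_num) hN'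
  have hd' : (2 : ℝ) ^ d ≤ 8 * N := by exact_mod_cast hd
  have h1 : d * Real.log 2 ≤ 3 * Real.log 2 + Real.log N := by
    have := Real.log_le_log (by positivity) hd'
    rw [Real.log_pow, Real.log_mul (by norm_num) (by positivity),
      show (8 : ℝ) = 2 ^ 3 by norm_num, Real.log_pow] at this
    exact_mod_cast this
  -- From `N ≥ 2` one gets `d * log 2 ≤ 4 * log N`, and `log 2 > 1 / 2`. The latter also gives `h3`,
  -- which absorbs the term without a logarithm.
  have h2 : (d : ℝ) ≤ 8 * Real.log N := by nlinarith
  have h3 : 1 ≤ 2 * Real.log N := by linarith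
  push_cast
  have h4 : 3 * (d : ℝ) * 2 ^ d ≤ 3 * (8 * Real.log N) * (8 * N) := by gcongr
  have h5 : (2 : ℝ) ^ d * (γ + 1) ≤ 8 * N * (γ + 1) * (2 * Real.log N) := by
    calc (2 : ℝ) ^ d * (γ + 1) ≤ 8 * N * (γ + 1) * 1 := by
          rw [mul_one]
          gcongr
      _ ≤ _ := by gcongr
  calc (K : ℝ) * (3 * d * 2 ^ d + 2 ^ d * (γ + 1))
      ≤ K * (3 * (8 * Real.log N) * (8 * N) + 8 * N * (γ + 1) * (2 * Real.log N)) := by gcongr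
    _ = _ := by ring

end UniversalQC

theorem theorem3 (G : Set UniversalQC.Gate) (hfin : G.Finite)
    (hwidth : ∀ g ∈ G, g.width = 1 ∨ g.width = 2)
    (hctrl : UniversalQC.ClosedUnderControl G)
    (hswap : UniversalQC.Implementable G UniversalQC.swapOp) :
    ∃ (k : ℝ) (m : ℕ → ℕ → ℕ) (U : (n c : ℕ) → UniversalQC.Circuit (n + m n c)),
      ∀ n c : ℕ, 0 < n →
        (U n c).IsOver G ∧
        (U n c).IsUniversalFor (UniversalQC.circuitsOfSize G n c) ∧
        ((U n c).size : ℝ) ≤ k * ((n : ℝ) + c) * Real.log ((n : ℝ) + c) := by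
  obtain ⟨K, hK⟩ := UniversalQC.exists_programmable_move hfin hctrl hswap
  obtain ⟨Γ, hΓ, hΓ'⟩ := UniversalQC.exists_gate_list hfin hwidth
  have key : ∀ n c : ℕ, ∃ (m : ℕ) (U : UniversalQC.Circuit (n + m)), 0 < n →
      U.IsOver G ∧ U.IsUniversalFor (UniversalQC.circuitsOfSize G n c) ∧
        (U.size : ℝ) ≤ (K * (192 + 16 * (Γ.length + 1)) : ℝ) * ((n : ℝ) + c) *
          Real.log ((n : ℝ) + c) := by
    intro n c
    rcases Nat.eq_zero_or_pos n with hn | hn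
    · exact ⟨0, [], fun h => absurd hn h.ne'⟩
    -- For `n = 1` and `c = 0` the bound is zero, so only the empty circuit will do. For `c > 0` one
    -- has `n + c ≥ 2` and the logarithm is bounded below.
    rcases Nat.eq_zero_or_pos c with hc | hc
    · subst hc
      refine ⟨0, [], fun _ => ⟨fun p hp => by simp at hp, fun C hC => ?_, ?_⟩⟩
      · have h0 : C = [] := List.length_eq_zero_iff.1 (Nat.le_zero.1 hC.2)
        subst h0
        exact ⟨Fin.elim0, fun y => by simp [UniversalQC.Circuit.toOp]⟩
      · have h1 : (1 : ℝ) ≤ n := by exact_mod_cast hn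
        have h2 : 0 ≤ Real.log ((n : ℝ) + (0 : ℕ)) := Real.log_nonneg (by simpa using h1)
        have h3 : (UniversalQC.Circuit.size ([] : UniversalQC.Circuit (n + 0)) : ℝ) = 0 := by
          simp [UniversalQC.Circuit.size]
        rw [h3]
        positivity
    · obtain ⟨d, hd, hd'⟩ : ∃ d, 2 * n + 3 * c < 2 ^ d ∧ 2 ^ d ≤ 8 * (n + c) := by
        refine ⟨Nat.log 2 (2 * n + 3 * c) + 1, Nat.lt_pow_succ_log_self (by norm_num) _, ?_⟩
        have := Nat.pow_log_le_self 2 (x := 2 * n + 3 * c) (by omega)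
        rw [pow_succ]
        omega
      obtain ⟨m, U, h1, h2, h3⟩ :=
        UniversalQC.exists_universal_circuit hK hwidth hΓ hΓ' hn hd
      refine ⟨m, U, fun _ => ⟨h1, h2, ?_⟩⟩
      have h4 := UniversalQC.cost_le_mul_log (K := K) (γ := Γ.length) (N := n + c) (by omega) hd'
      push_cast at h4
      refine le_trans ?_ h4
      exact_mod_cast h3
  choose m U hU using key
  exact ⟨_, m, U, hU⟩
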